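/- Let $G$ be a (simple, not necessarily connected) graph of finite maximum degree, and let $\varepsilon$ be a thick end of $G$. Then $G$ has a diverging double ray all of whose tails lie in $\varepsilon$. Here a ray is a one-way infinite path, a double ray is a two-way infinite path, and a tail of a (double) ray is any ray contained in it. An end of $G$ is an equivalence class of rays, where two rays are equivalent if they are joined by infinitely many pairwise disjoint paths in $G$; it is thick if for every $n\in\mathbb N$ it contains $n$ pairwise disjoint rays. Two rays $R,S$ diverge if for every $n\in\mathbb N$ they have tails $R'\subseteq R$ and $S'\subseteq S$ with $d_G(R',S')>n$, where $d_G(R',S')$ is the minimum distance in $G$ between a vertex of $R'$ and a vertex of $S'$. A double ray diverges if every two disjoint tails of it diverge. -/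

import Mathlib

namespace SimpleGraph

universe u

variable {V : Type u} {G : SimpleGraph V}

/-- A ray: a one-way infinite path, with its vertices listed from the first one on. -/
structure Ray (G : SimpleGraph V) where
  vert : ℕ → V
  inj : Function.Injective vert
  adj : ∀ n, G.Adj (vert n) (vert (n + 1))

/-- A double ray: a two-way infinite path. -/
structure DoubleRay (G : SimpleGraph V) where
  vert : ℤ → V
  inj : Function.Injective vert
  adj : ∀ n, G.Adj (vert n) (vert (n + 1))

namespace Ray

/-- The vertex set of a ray. -/
def verts (R : G.Ray) : Set V := Set.range R.vert

/-- `T` is a tail (subray) of the ray `R`. -/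
def IsTail (T R : G.Ray) : Prop := ∃ k : ℕ, ∀ n, T.vert n = R.vert (k + n)

/-- Two rays are equivalent if they are joined by infinitely many pairwise disjoint paths
(a path may be trivial, where the rays meet). -/
def Equivalent (R S : G.Ray) : Prop :=
  ∃ (a b : ℕ → V) (p : ∀ n, G.Walk (a n) (b n)),
    (∀ n, a n ∈ R.verts ∧ b n ∈ S.verts ∧ (p n).IsPath) ∧
    ∀ m n, m ≠ n → (p m).support.Disjoint (p n).support

/-- Any two vertices of a ray are joined by a walk that stays on the ray, beyond any index that
bounds both from below. -/
theorem exists_walk (R : G.Ray) (N i j : ℕ) (hi : N ≤ i) (hj : N ≤ j) :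
    ∃ p : G.Walk (R.vert i) (R.vert j), ∀ v ∈ p.support, ∃ k, N ≤ k ∧ v = R.vert k := by
  have key : ∀ d i, N ≤ i → ∃ p : G.Walk (R.vert i) (R.vert (i + d)),
      ∀ v ∈ p.support, ∃ k, N ≤ k ∧ v = R.vert k := by
    intro d
    induction d with
    | zero => intro i hi; exact ⟨.nil, by simpa using ⟨i, hi, rfl⟩⟩
    | succ d ih =>
      intro i hi
      obtain ⟨p, hp⟩ := ih i hi
      refine ⟨p.append (Walk.cons (R.adj (i + d)) Walk.nil), ?_⟩
      intro v hv
      rw [Walk.mem_support_append_iff] at hv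
      rcases hv with hv | hv
      · exact hp v hv
      · simp only [Walk.support_cons, Walk.support_nil, List.mem_cons, List.not_mem_nil,
          or_false] at hv
        rcases hv with rfl | rfl
        · exact ⟨i + d, by omega, rfl⟩
        · exact ⟨i + d + 1, by omega, rfl⟩
  rcases le_total i j with h | h
  · obtain ⟨d, rfl⟩ := Nat.exists_eq_add_of_le h
    exact key d i hi
  · obtain ⟨d, rfl⟩ := Nat.exists_eq_add_of_le h
    obtain ⟨p, hp⟩ := key d j hj
    exact ⟨p.reverse, by simpa using hp⟩

theorem exists_avoids (R : G.Ray) (U : Finset V) : ∃ N, ∀ k, N ≤ k → R.vert k ∉ U := by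
  have h : (R.vert ⁻¹' (U : Set V)).Finite := U.finite_toSet.preimage R.inj.injOn
  obtain ⟨N, hN⟩ := h.bddAbove
  exact ⟨N + 1, fun k hk hkU => by have := hN (show k ∈ R.vert ⁻¹' (U : Set V) from hkU); omega⟩

/-- Two rays are equivalent if and only if, for every finite set `U` of vertices, they have tails
in the same component of the graph minus `U`. -/
theorem equivalent_iff (R S : G.Ray) : R.Equivalent S ↔
    ∀ U : Finset V, ∃ N, ∀ i j, N ≤ i → N ≤ j →
      ∃ p : G.Walk (R.vert i) (S.vert j), ∀ v ∈ p.support, v ∉ U := by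
  classical
  constructor
  · rintro ⟨a, b, p, hp, hd⟩ U
    obtain ⟨N, hN⟩ := R.exists_avoids U
    obtain ⟨M, hM⟩ := S.exists_avoids U
    set W : Finset V := U ∪ (Finset.range N).image R.vert ∪ (Finset.range M).image S.vert with hW
    obtain ⟨n, hn⟩ : ∃ n, ∀ v ∈ (p n).support, v ∉ W := by
      by_contra! hcon
      choose f hf hfW using hcon
      have hinj : Function.Injective f := by
        intro m n hmn
        by_contra hne
        exact hd m n hne (hf m) (hmn ▸ hf n)
      exact (Set.infinite_range_of_injective hinj)
        (W.finite_toSet.subset (by rintro _ ⟨n, rfl⟩; exact hfW n))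
    obtain ⟨⟨i₀, hi₀⟩, ⟨j₀, hj₀⟩, -⟩ := hp n
    have hiN : N ≤ i₀ := by
      by_contra hlt
      refine hn _ (p n).start_mem_support ?_
      rw [← hi₀, hW]
      simp only [Finset.mem_union, Finset.mem_image, Finset.mem_range]
      exact Or.inl (Or.inr ⟨i₀, by omega, rfl⟩)
    have hjM : M ≤ j₀ := by
      by_contra hlt
      refine hn _ (p n).end_mem_support ?_
      rw [← hj₀, hW]
      simp only [Finset.mem_union, Finset.mem_image, Finset.mem_range]
      exact Or.inr ⟨j₀, by omega, rfl⟩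
    refine ⟨max N M, fun i j hi hj => ?_⟩
    obtain ⟨q, hq⟩ := R.exists_walk N i i₀ (by omega) hiN
    obtain ⟨r, hr⟩ := S.exists_walk M j₀ j hjM (by omega)
    refine ⟨(q.append ((p n).copy hi₀.symm hj₀.symm)).append r, fun v hv => ?_⟩
    rw [Walk.mem_support_append_iff, Walk.mem_support_append_iff, Walk.support_copy] at hv
    rcases hv with (hv | hv) | hv
    · obtain ⟨k, hk, rfl⟩ := hq v hv
      exact hN k hk
    · exact fun hU => hn v hv (by rw [hW]; simp [hU])
    · obtain ⟨k, hk, rfl⟩ := hr v hv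
      exact hM k hk
  · intro h
    obtain ⟨f, hf, hdis⟩ := exists_seq_of_forall_finset_exists
      (α := Σ a b : V, G.Walk a b)
      (fun x => x.1 ∈ R.verts ∧ x.2.1 ∈ S.verts ∧ x.2.2.IsPath)
      (fun x y => x.2.2.support.Disjoint y.2.2.support) (by
        intro s _
        obtain ⟨N, hN⟩ := h (s.biUnion fun x => x.2.2.support.toFinset)
        obtain ⟨p, hp⟩ := hN N N le_rfl le_rfl
        refine ⟨⟨_, _, p.bypass⟩, ⟨⟨N, rfl⟩, ⟨N, rfl⟩, p.bypass_isPath⟩, ?_⟩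
        intro x hx v hvx hv
        refine hp v (p.support_bypass_subset_support hv) ?_
        simp only [Finset.mem_biUnion, List.mem_toFinset]
        exact ⟨x, hx, hvx⟩)
    refine ⟨fun n => (f n).1, fun n => (f n).2.1, fun n => (f n).2.2, hf, fun m n hmn => ?_⟩
    rcases lt_or_gt_of_ne hmn with hlt | hlt
    · exact hdis m n hlt
    · exact (hdis n m hlt).symm

theorem equivalent_equivalence (G : SimpleGraph V) : Equivalence (Equivalent (G := G)) where
  refl R := (equivalent_iff R R).2 fun U => by
    obtain ⟨N, hN⟩ := R.exists_avoids U
    refine ⟨N, fun i j hi hj => ?_⟩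
    obtain ⟨p, hp⟩ := R.exists_walk N i j hi hj
    refine ⟨p, fun v hv => ?_⟩
    obtain ⟨k, hk, rfl⟩ := hp v hv
    exact hN k hk
  symm {R S} h := (equivalent_iff S R).2 fun U => by
    obtain ⟨N, hN⟩ := (equivalent_iff R S).1 h U
    refine ⟨N, fun i j hi hj => ?_⟩
    obtain ⟨p, hp⟩ := hN j i hj hi
    exact ⟨p.reverse, by simpa using hp⟩
  trans {R S T} h h' := (equivalent_iff R T).2 fun U => by
    obtain ⟨N, hN⟩ := (equivalent_iff R S).1 h U
    obtain ⟨M, hM⟩ := (equivalent_iff S T).1 h' U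
    refine ⟨max N M, fun i j hi hj => ?_⟩
    obtain ⟨p, hp⟩ := hN i (max N M) (by omega) (by omega)
    obtain ⟨q, hq⟩ := hM (max N M) j (by omega) (by omega)
    refine ⟨p.append q, fun v hv => ?_⟩
    rw [Walk.mem_support_append_iff] at hv
    exact hv.elim (hp v) (hq v)

/-- The equivalence of rays, as a setoid. -/
def setoid (G : SimpleGraph V) : Setoid G.Ray := ⟨Equivalent, equivalent_equivalence G⟩

end Ray

/-- The ends of a graph: the equivalence classes of its rays. -/
def RayEnd (G : SimpleGraph V) : Type u := Quotient (Ray.setoid G)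

/-- The end that contains a given ray. -/
def Ray.toEnd (R : G.Ray) : G.RayEnd := Quotient.mk (Ray.setoid G) R

/-- An end is thick if, for every `n`, it contains `n` pairwise disjoint rays. -/
def RayEnd.IsThick (ε : G.RayEnd) : Prop :=
  ∀ n : ℕ, ∃ R : Fin n → G.Ray,
    (∀ i, (R i).toEnd = ε) ∧ ∀ i j, i ≠ j → Disjoint (R i).verts (R j).verts

/-- The distance between two sets of vertices (`⊤` if no path joins them). -/
noncomputable def setEDist (G : SimpleGraph V) (U W : Set V) : ℕ∞ :=
  ⨅ u ∈ U, ⨅ w ∈ W, G.edist u w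

/-- Two rays diverge if, for every `n`, they have tails at distance more than `n`. -/
def Ray.Diverge (R S : G.Ray) : Prop :=
  ∀ n : ℕ, ∃ R' S' : G.Ray, R'.IsTail R ∧ S'.IsTail S ∧ (n : ℕ∞) < G.setEDist R'.verts S'.verts

/-- `T` is a tail (subray) of the double ray `D`, in one of its two directions. -/
def Ray.IsTailOfDouble (T : G.Ray) (D : G.DoubleRay) : Prop :=
  (∃ k : ℤ, ∀ n : ℕ, T.vert n = D.vert (k + n)) ∨ (∃ k : ℤ, ∀ n : ℕ, T.vert n = D.vert (k - n))

/-- All tails of the double ray `D` lie in the end `ε`. -/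
def DoubleRay.LiesIn (D : G.DoubleRay) (ε : G.RayEnd) : Prop :=
  ∀ T : G.Ray, T.IsTailOfDouble D → T.toEnd = ε

/-- A double ray diverges if every two disjoint tails of it diverge. -/
def DoubleRay.Diverges (D : G.DoubleRay) : Prop :=
  ∀ T T' : G.Ray, T.IsTailOfDouble D → T'.IsTailOfDouble D → Disjoint T.verts T'.verts →
    T.Diverge T'

end SimpleGraph

/-!
Let `o` be a vertex from which the thick end can be reached. Replace the component of `o` by its
power graph `H`, in which `u` and `v` are adjacent if their distance is at most `f` at the larger of
their distances from `o`, where `f` tends to infinity. Sets at distance more than three in `H`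
expand to sets of `G` that diverge, so it suffices to find two connected sets at distance more than
three in `H` that both accumulate at the end.

By thickness the end contains more disjoint rays than a ball of given radius has vertices. As the
degrees are bounded, `f` can grow so slowly that every ball of radius `1010` in `H` far from `o`
misses a ray of the end that starts near `o`. Let `R` be a geodesic ray of `H` from `o` that
converges to the end. Late balls of this radius around `R` do not separate `R 0` from the end, so
some component of the vertices far from `R` jumps over the centre of the ball. Should one connected
set far from `R` come close to `R` arbitrarily late, then this set and `R` are as required.
Otherwise there is a chain of jumps, each starting before the last one ends. Consecutive
jumps that are close to each other are merged into blocks, and each of two routes alternates between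
jumping with every other block and following `R` to the start of its next block.
-/

namespace ThickEnd

open SimpleGraph

section Reachability

variable {V : Type*} {K : SimpleGraph V} {S T : Set V} {x y z : V}

/-- Two vertices are joined by a walk all of whose vertices lie in `S`. -/
def ReachableIn (K : SimpleGraph V) (S : Set V) (x y : V) : Prop :=
  ∃ p : K.Walk x y, ∀ v ∈ p.support, v ∈ S

/-- Any two vertices of `S` are joined by a walk inside `S`; the empty set is allowed. -/
def ConnectedOn (K : SimpleGraph V) (S : Set V) : Prop :=
  ∀ x ∈ S, ∀ y ∈ S, ReachableIn K S x y

namespace ReachableIn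

theorem refl (h : x ∈ S) : ReachableIn K S x x := ⟨.nil, by simpa using h⟩

theorem symm (h : ReachableIn K S x y) : ReachableIn K S y x := by
  obtain ⟨p, hp⟩ := h
  exact ⟨p.reverse, by simpa using hp⟩

theorem trans (h : ReachableIn K S x y) (h' : ReachableIn K S y z) : ReachableIn K S x z := by
  obtain ⟨p, hp⟩ := h
  obtain ⟨q, hq⟩ := h'
  refine ⟨p.append q, fun v hv => ?_⟩
  rw [Walk.mem_support_append_iff] at hv
  exact hv.elim (hp v) (hq v)

theorem mono (hST : S ⊆ T) (h : ReachableIn K S x y) : ReachableIn K T x y := by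
  obtain ⟨p, hp⟩ := h
  exact ⟨p, fun v hv => hST (hp v hv)⟩

theorem mem_left (h : ReachableIn K S x y) : x ∈ S := by
  obtain ⟨p, hp⟩ := h
  exact hp _ p.start_mem_support

theorem mem_right (h : ReachableIn K S x y) : y ∈ S := h.symm.mem_left

theorem of_adj (h : K.Adj x y) (hx : x ∈ S) (hy : y ∈ S) : ReachableIn K S x y :=
  ⟨.cons h .nil, by simp [hx, hy]⟩

theorem of_dist (hxy : K.Reachable x y)
    (h : ∀ v, K.Reachable x v → K.dist x v + K.dist v y = K.dist x y → v ∈ S) :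
    ReachableIn K S x y := by
  classical
  obtain ⟨p, hp⟩ := hxy.exists_walk_length_eq_dist
  refine ⟨p, fun v hv => h v (p.takeUntil v hv).reachable ?_⟩
  have htake := dist_le (p.takeUntil v hv)
  have hdrop := dist_le (p.dropUntil v hv)
  have hlength := congrArg Walk.length (p.take_spec hv)
  rw [Walk.length_append] at hlength
  have := (p.takeUntil v hv).reachable.dist_triangle_left y
  omega

theorem induct {P : V → Prop} (hP : ∀ u v, u ∈ S → v ∈ S → K.Adj u v → P u → P v)
    (h : ReachableIn K S x y) (hx : P x) : P y := by
  obtain ⟨p, hp⟩ := h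
  induction p with
  | nil => exact hx
  | cons hadj p ih =>
    simp only [Walk.support_cons, List.mem_cons, forall_eq_or_imp] at hp
    exact ih (hP _ _ hp.1 (hp.2 _ p.start_mem_support) hadj hx) hp.2

theorem of_seq {f : ℕ → V} {a b : ℕ} (hab : a ≤ b)
    (hadj : ∀ n, a ≤ n → n < b → K.Adj (f n) (f (n + 1)))
    (hS : ∀ n, a ≤ n → n ≤ b → f n ∈ S) : ReachableIn K S (f a) (f b) := by
  induction b, hab using Nat.le_induction with
  | base => exact refl (hS a le_rfl le_rfl)
  | succ n hn ih =>
    exact (ih (fun k h1 h2 => hadj k h1 (by omega)) (fun k h1 h2 => hS k h1 (by omega))).trans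
      (of_adj (hadj n hn (by omega)) (hS n hn (by omega)) (hS (n + 1) (by omega) le_rfl))

end ReachableIn

theorem connectedOn_of_reachableIn (h : ∀ y ∈ S, ReachableIn K S x y) : ConnectedOn K S :=
  fun y hy z hz => (h y hy).symm.trans (h z hz)

theorem ConnectedOn.union (hS : ConnectedOn K S) (hT : ConnectedOn K T) (hxS : x ∈ S)
    (hxT : x ∈ T) : ConnectedOn K (S ∪ T) := by
  refine connectedOn_of_reachableIn (x := x) ?_
  rintro y (hy | hy)
  · exact (hS x hxS y hy).mono Set.subset_union_left
  · exact (hT x hxT y hy).mono Set.subset_union_right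

theorem ConnectedOn.iUnion_seq {T : ℕ → Set V} (hT : ∀ n, ConnectedOn K (T n))
    (hne : ∀ n, (T n ∩ T (n + 1)).Nonempty) : ConnectedOn K (⋃ n, T n) := by
  have hsub : ∀ n, T n ⊆ ⋃ n, T n := Set.subset_iUnion T
  choose x hx using hne
  have key : ∀ n, ∀ y ∈ T n, ReachableIn K (⋃ n, T n) (x 0) y := by
    intro n
    induction n with
    | zero => exact fun y hy => (hT 0 _ (hx 0).1 y hy).mono (hsub 0)
    | succ n ih =>
      exact fun y hy => (ih _ (hx n).1).trans ((hT (n + 1) _ (hx n).2 y hy).mono (hsub _))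
  refine connectedOn_of_reachableIn (x := x 0) fun y hy => ?_
  obtain ⟨n, hn⟩ := Set.mem_iUnion.1 hy
  exact key n y hn

end Reachability

section Balls

variable {V : Type*} {G : SimpleGraph V}

theorem edist_le_succ_subset (v : V) (r : ℕ) :
    {w | G.edist v w ≤ (r + 1 : ℕ)} ⊆ {v} ∪ ⋃ u ∈ G.neighborSet v, {w | G.edist u w ≤ r} := by
  intro w hw
  obtain ⟨p, hp⟩ := exists_walk_of_edist_ne_top (ne_top_of_le_ne_top (ENat.natCast_ne_top _) hw)
  have hlen : p.length ≤ r + 1 := by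
    rw [← ENat.natCast_le_natCast, hp]
    exact hw
  cases p with
  | nil => exact Or.inl rfl
  | @cons _ u _ hvu q =>
    rw [Walk.length_cons] at hlen
    exact Or.inr (Set.mem_biUnion (x := u) hvu
      ((edist_le q).trans (by exact_mod_cast Nat.le_of_succ_le_succ hlen)))

theorem finite_edist_le (hfin : ∀ v, (G.neighborSet v).Finite) (v : V) (r : ℕ) :
    {w | G.edist v w ≤ r}.Finite := by
  induction r generalizing v with
  | zero => simp
  | succ r ih =>
    exact ((Set.finite_singleton v).union ((hfin v).biUnion fun u _ => ih u)).subset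
      (edist_le_succ_subset v r)

theorem encard_edist_le {Δ : ℕ} (hdeg : ∀ v, (G.neighborSet v).encard ≤ Δ) (v : V) (r : ℕ) :
    {w | G.edist v w ≤ r}.encard ≤ ((Δ + 1) ^ r : ℕ) := by
  induction r generalizing v with
  | zero => simp
  | succ r ih =>
    have hnbr : (G.neighborSet v).Finite := Set.finite_of_encard_le_coe (hdeg v)
    have hunion : (⋃ u ∈ G.neighborSet v, {w | G.edist u w ≤ r}).encard ≤
        (Δ * (Δ + 1) ^ r : ℕ) := by
      have hcard : hnbr.toFinset.card ≤ Δ := by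
        rw [← ENat.natCast_le_natCast, ← hnbr.encard_eq_coe_toFinset_card]
        exact hdeg v
      calc (⋃ u ∈ G.neighborSet v, {w | G.edist u w ≤ r}).encard
          = (⋃ u ∈ hnbr.toFinset, {w | G.edist u w ≤ r}).encard := by simp
        _ ≤ ∑ u ∈ hnbr.toFinset, {w | G.edist u w ≤ r}.encard :=
            Finset.set_encard_biUnion_le _ _
        _ ≤ ∑ _u ∈ hnbr.toFinset, (((Δ + 1) ^ r : ℕ) : ℕ∞) :=
            Finset.sum_le_sum fun u _ => ih u
        _ = (hnbr.toFinset.card * (Δ + 1) ^ r : ℕ) := by simp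
        _ ≤ (Δ * (Δ + 1) ^ r : ℕ) := by exact_mod_cast Nat.mul_le_mul_right _ hcard
    have hpow : 1 + Δ * (Δ + 1) ^ r ≤ (Δ + 1) ^ (r + 1) := by
      have := Nat.one_le_pow r (Δ + 1) (by omega)
      rw [pow_succ]
      linarith
    calc {w | G.edist v w ≤ (r + 1 : ℕ)}.encard
        ≤ ({v} ∪ ⋃ u ∈ G.neighborSet v, {w | G.edist u w ≤ r}).encard :=
          Set.encard_le_encard (edist_le_succ_subset v r)
      _ ≤ 1 + (Δ * (Δ + 1) ^ r : ℕ) := by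
          refine (Set.encard_union_le _ _).trans (add_le_add ?_ hunion)
          simp
      _ ≤ ((Δ + 1) ^ (r + 1) : ℕ) := by exact_mod_cast hpow

end Balls

section GeodesicRays

variable {V : Type*} {K : SimpleGraph V} {Y : ℕ → V}

/-- The vertex sequence of a geodesic ray: an isometric embedding of `ℕ`. -/
def IsGeodesicRay (K : SimpleGraph V) (Y : ℕ → V) : Prop :=
  ∀ i j, i ≤ j → K.dist (Y i) (Y j) = j - i

theorem isGeodesicRay_of_adj (hK : K.Connected) (hadj : ∀ n, K.Adj (Y n) (Y (n + 1)))
    (hd : ∀ n, K.dist (Y 0) (Y n) = n) : IsGeodesicRay K Y := by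
  intro i j hij
  have hle : K.dist (Y i) (Y j) ≤ j - i := by
    induction j, hij using Nat.le_induction with
    | base => simp
    | succ n hn ih =>
      have := hK.dist_triangle (u := Y i) (v := Y n) (w := Y (n + 1))
      rw [dist_eq_one_iff_adj.2 (hadj n)] at this
      omega
  have := hK.dist_triangle (u := Y 0) (v := Y i) (w := Y j)
  rw [hd, hd] at this
  omega

theorem IsGeodesicRay.adj (hY : IsGeodesicRay K Y) (n : ℕ) : K.Adj (Y n) (Y (n + 1)) :=
  dist_eq_one_iff_adj.1 (by rw [hY n (n + 1) n.le_succ]; omega)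

theorem IsGeodesicRay.injective (hY : IsGeodesicRay K Y) : Function.Injective Y := by
  intro i j hij
  rcases le_total i j with h | h
  · have := hY i j h
    rw [hij, SimpleGraph.dist_self] at this
    omega
  · have := hY j i h
    rw [hij, SimpleGraph.dist_self] at this
    omega

theorem exists_adj_dist_eq_succ (hK : K.Connected) {v w : V} (hvw : v ≠ w) :
    ∃ u, K.Adj v u ∧ K.dist v w = 1 + K.dist u w := by
  obtain ⟨p, hp⟩ := hK.exists_walk_length_eq_dist v w
  cases p with
  | nil => exact absurd rfl hvw
  | @cons _ u _ h q =>
    refine ⟨u, h, ?_⟩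
    have hq := dist_le q
    have := hK.dist_triangle (u := v) (v := u) (w := w)
    rw [dist_eq_one_iff_adj.2 h] at this
    rw [Walk.length_cons] at hp
    omega

theorem finite_dist_le (hK : K.Connected) (hfin : ∀ v, (K.neighborSet v).Finite) (o : V) (n : ℕ) :
    {v | K.dist o v ≤ n}.Finite := by
  refine (finite_edist_le hfin o n).subset fun v hv => ?_
  exact (hK o v).coe_dist_eq_edist.symm.trans_le (by exact_mod_cast hv)

/-- The vertices of `X` that are reached from `o` by a geodesic through `y`. -/
def geodesicallyBeyond (K : SimpleGraph V) (o : V) (X : Set V) (y : V) : Set V :=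
  {x ∈ X | K.dist o x = K.dist o y + K.dist y x}

theorem exists_adj_infinite_geodesicallyBeyond (hK : K.Connected)
    (hfin : ∀ v, (K.neighborSet v).Finite) {o y : V} {X : Set V}
    (hy : (geodesicallyBeyond K o X y).Infinite) :
    ∃ w, K.Adj y w ∧ K.dist o w = K.dist o y + 1 ∧ (geodesicallyBeyond K o X w).Infinite := by
  have hcov : geodesicallyBeyond K o X y \ {y} ⊆
      ⋃ w ∈ K.neighborSet y, {x ∈ geodesicallyBeyond K o X y | K.dist y x = 1 + K.dist w x} := by
    rintro x ⟨hx, hxy⟩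
    obtain ⟨w, hw, hd⟩ := exists_adj_dist_eq_succ hK (Ne.symm hxy)
    exact Set.mem_biUnion (x := w) hw ⟨hx, hd⟩
  obtain ⟨w, hw, hinf⟩ : ∃ w ∈ K.neighborSet y,
      {x ∈ geodesicallyBeyond K o X y | K.dist y x = 1 + K.dist w x}.Infinite := by
    by_contra! hcon
    exact (hy.sdiff (Set.finite_singleton y))
      (((hfin y).biUnion fun w hw => hcon w hw).subset hcov)
  have hyw := dist_eq_one_iff_adj.2 hw
  have hdist : K.dist o w = K.dist o y + 1 := by
    obtain ⟨x, ⟨-, hx⟩, hx'⟩ := hinf.nonempty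
    have hox := hK.dist_triangle (u := o) (v := w) (w := x)
    have how := hK.dist_triangle (u := o) (v := y) (w := w)
    omega
  refine ⟨w, hw, hdist, hinf.mono ?_⟩
  rintro x ⟨⟨hxX, hx⟩, hx'⟩
  exact ⟨hxX, by omega⟩

theorem exists_geodesicRay_infinite_geodesicallyBeyond (hK : K.Connected)
    (hfin : ∀ v, (K.neighborSet v).Finite) (o : V) {X : Set V} (hX : X.Infinite) :
    ∃ Y : ℕ → V, Y 0 = o ∧ IsGeodesicRay K Y ∧
      ∀ n, (geodesicallyBeyond K o X (Y n)).Infinite := by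
  have hbase : (geodesicallyBeyond K o X o).Infinite := by simpa [geodesicallyBeyond] using hX
  choose! g hadj hdist hinf using fun y =>
    exists_adj_infinite_geodesicallyBeyond (y := y) (o := o) (X := X) hK hfin
  have hY : ∀ n, g^[n + 1] o = g (g^[n] o) := fun n => Function.iterate_succ_apply' g n o
  have hYinf : ∀ n, (geodesicallyBeyond K o X (g^[n] o)).Infinite := by
    intro n
    induction n with
    | zero => exact hbase
    | succ n ih => rw [hY]; exact hinf _ ih
  have hYdist : ∀ n, K.dist o (g^[n] o) = n := by
    intro n
    induction n with
    | zero => simp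
    | succ n ih => rw [hY, hdist _ (hYinf n), ih]
  exact ⟨fun n => g^[n] o, rfl, isGeodesicRay_of_adj hK
    (fun n => by rw [hY]; exact hadj _ (hYinf n)) hYdist, hYinf⟩

end GeodesicRays

section Separation

variable {V : Type*} {H : SimpleGraph V} {m n δ δ' : ℕ} {X Y X' Y' S : Set V} {x y u : V}

/-- Two sets of vertices at distance more than `n`. As `dist` is `0` between different components,
this is meant for connected graphs. -/
def Apart (H : SimpleGraph V) (n : ℕ) (X Y : Set V) : Prop :=
  ∀ x ∈ X, ∀ y ∈ Y, n < H.dist x y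

namespace Apart

theorem symm (h : Apart H n X Y) : Apart H n Y X := fun y hy x hx => by
  rw [SimpleGraph.dist_comm]; exact h x hx y hy

theorem mono (hX : X' ⊆ X) (hY : Y' ⊆ Y) (h : Apart H n X Y) : Apart H n X' Y' :=
  fun x hx y hy => h x (hX hx) y (hY hy)

theorem of_le (hmn : m ≤ n) (h : Apart H n X Y) : Apart H m X Y :=
  fun x hx y hy => hmn.trans_lt (h x hx y hy)

theorem union_left (h : Apart H n X Y) (h' : Apart H n X' Y) : Apart H n (X ∪ X') Y :=
  fun x hx => hx.elim (h x) (h' x)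

theorem union_right (h : Apart H n X Y) (h' : Apart H n X Y') : Apart H n X (Y ∪ Y') :=
  (h.symm.union_left h'.symm).symm

theorem iUnion {ι κ : Sort*} {X : ι → Set V} {Y : κ → Set V}
    (h : ∀ i j, Apart H n (X i) (Y j)) : Apart H n (⋃ i, X i) (⋃ j, Y j) := fun x hx y hy => by
  obtain ⟨i, hi⟩ := Set.mem_iUnion.1 hx
  obtain ⟨j, hj⟩ := Set.mem_iUnion.1 hy
  exact h i j x hi y hj

end Apart

/-- The vertices on walks of length at most `δ` between `X` and `Y`. -/
def bridge (H : SimpleGraph V) (X Y : Set V) (δ : ℕ) : Set V :=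
  {u | ∃ x ∈ X, ∃ y ∈ Y, H.dist x u + H.dist u y ≤ δ}

theorem bridge_comm (X Y : Set V) (δ : ℕ) : bridge H X Y δ = bridge H Y X δ := by
  have key : ∀ X Y, bridge H X Y δ ⊆ bridge H Y X δ := by
    rintro X Y u ⟨x, hx, y, hy, h⟩
    exact ⟨y, hy, x, hx, by rwa [SimpleGraph.dist_comm, add_comm, SimpleGraph.dist_comm]⟩
  exact (key X Y).antisymm (key Y X)

theorem mem_bridge_left (hx : x ∈ X) (hy : y ∈ Y) (h : H.dist x y ≤ δ) : x ∈ bridge H X Y δ :=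
  ⟨x, hx, y, hy, by simpa using h⟩

theorem mem_bridge_right (hx : x ∈ X) (hy : y ∈ Y) (h : H.dist x y ≤ δ) : y ∈ bridge H X Y δ :=
  ⟨x, hx, y, hy, by simpa using h⟩

theorem subset_bridge_self : X ⊆ bridge H X X 0 := fun _ hx => mem_bridge_left hx hx (by simp)

theorem exists_reachableIn_bridge (hH : H.Connected) (hu : u ∈ bridge H X Y δ) :
    ∃ x ∈ X, ReachableIn H (bridge H X Y δ) x u := by
  obtain ⟨x, hx, y, hy, hd⟩ := hu
  refine ⟨x, hx, .of_dist (hH x u) fun v _ hv => ⟨x, hx, y, hy, ?_⟩⟩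
  have := hH.dist_triangle (u := v) (v := u) (w := y)
  omega

theorem ConnectedOn.union_bridge (hH : H.Connected) (hS : ConnectedOn H S) (hX : X ⊆ S) :
    ConnectedOn H (S ∪ bridge H X Y δ) := by
  have key : ∀ u ∈ S ∪ bridge H X Y δ, ∃ x ∈ S, ReachableIn H (S ∪ bridge H X Y δ) x u := by
    rintro u (hu | hu)
    · exact ⟨u, hu, .refl (.inl hu)⟩
    · obtain ⟨x, hx, hxu⟩ := exists_reachableIn_bridge hH hu
      exact ⟨x, hX hx, hxu.mono Set.subset_union_right⟩
  intro u hu w hw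
  obtain ⟨x, hx, hxu⟩ := key u hu
  obtain ⟨y, hy, hyw⟩ := key w hw
  exact (hxu.symm.trans ((hS x hx y hy).mono Set.subset_union_left)).trans hyw

theorem Apart.bridge_left (hH : H.Connected) (h : Apart H m X X') (hmn : n + δ ≤ m) :
    Apart H n (bridge H X Y δ) X' := by
  rintro u ⟨x, hx, y, -, hd⟩ w hw
  have := h x hx w hw
  have := hH.dist_triangle (u := x) (v := u) (w := w)
  omega

theorem Apart.bridge {m' : ℕ} (hH : H.Connected) (hX : Apart H m X X') (hY : Apart H m' Y Y')
    (hmn : δ + δ' + 2 * n ≤ m + m' + 1) :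
    Apart H n (bridge H X Y δ) (bridge H X' Y' δ') := by
  rintro u ⟨x, hx, y, hy, hu⟩ w ⟨x', hx', y', hy', hw⟩
  have := hX x hx x' hx'
  have := hY y hy y' hy'
  have := hH.dist_triangle (u := x) (v := u) (w := x')
  have := hH.dist_triangle (u := u) (v := w) (w := x')
  have := hH.dist_triangle (u := y) (v := u) (w := y')
  have := hH.dist_triangle (u := u) (v := w) (w := y')
  have := H.dist_comm (u := w) (v := x')
  have := H.dist_comm (u := u) (v := y)
  omega

end Separation

section Components

variable {V : Type*} {H : SimpleGraph V} {R : ℕ → V} {U E F : Set V} {u w x y : V}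
  {a b a' b' p q p' q' z δ : ℕ}

/-- `E` is a component of the subgraph of `H` induced by `U`. -/
structure IsComponentOf (H : SimpleGraph V) (U E : Set V) : Prop where
  subset : E ⊆ U
  connectedOn : ConnectedOn H E
  closed : ∀ x ∈ E, ∀ y ∈ U, H.Adj x y → y ∈ E

theorem IsComponentOf.subset_of_mem (hE : IsComponentOf H U E) (hF : IsComponentOf H U F)
    (hwE : w ∈ E) (hwF : w ∈ F) : E ⊆ F := fun x hx =>
  (hE.connectedOn w hwE x hx).induct (P := (· ∈ F))
    (fun u v _ hv h hu => hF.closed u hu v (hE.subset hv) h) hwF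

theorem IsComponentOf.eq_of_mem (hE : IsComponentOf H U E) (hF : IsComponentOf H U F)
    (hwE : w ∈ E) (hwF : w ∈ F) : E = F :=
  (hE.subset_of_mem hF hwE hwF).antisymm (hF.subset_of_mem hE hwF hwE)

theorem isComponentOf_setOf_reachableIn (U : Set V) (x : V) :
    IsComponentOf H U {y | ReachableIn H U x y} where
  subset _ hy := hy.mem_right
  connectedOn := connectedOn_of_reachableIn (x := x) fun y hxy =>
    (hxy.induct (P := fun v => ReachableIn H U x v ∧ ReachableIn H {y | ReachableIn H U x y} x v)
      (fun u v hu hv h ⟨hxu, hxu'⟩ => by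
        have hxv := hxu.trans (.of_adj h hu hv)
        exact ⟨hxv, hxu'.trans (.of_adj h hxu hxv)⟩)
      ⟨.refl hxy.mem_left, .refl (.refl hxy.mem_left)⟩).2
  closed _ hx _ hy h := hx.trans (.of_adj h hx.mem_right hy)

/-- The vertices at distance more than `m` from the sequence `R`. -/
def farSet (H : SimpleGraph V) (R : ℕ → V) (m : ℕ) : Set V := {v | ∀ z, m < H.dist v (R z)}

theorem notMem_farSet_self (m z : ℕ) : R z ∉ farSet H R m := fun h => by simpa using h z

theorem exists_dist_le_of_notMem_farSet {m : ℕ} (h : x ∉ farSet H R m) :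
    ∃ z, H.dist x (R z) ≤ m := by
  simpa [farSet] using h

/-- The index `z` is an attachment of `E` if `E` has a vertex at distance at most `11` from `R z`.
Any component of `farSet H R 10` has one, as every edge leaving it ends within `10` of `R`. -/
def Attached (H : SimpleGraph V) (R : ℕ → V) (E : Set V) (z : ℕ) : Prop :=
  ∃ x ∈ E, H.dist x (R z) ≤ 11

theorem attached_of_mem (h : R z ∈ E) : Attached H R E z := ⟨R z, h, by simp⟩

theorem IsComponentOf.exists_attached (hH : H.Connected)
    (hE : IsComponentOf H (farSet H R 10) E) (hx : x ∈ E) (hy : y ∉ E) :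
    ∃ z, Attached H R E z ∧ H.dist x (R z) ≤ H.dist x y + 10 := by
  obtain ⟨p, hp⟩ := hH.exists_walk_length_eq_dist x y
  rw [← hp]
  clear hp
  induction p with
  | nil => exact absurd hx hy
  | @cons x w y h q ih =>
    have hxw := dist_eq_one_iff_adj.2 h
    have tri : ∀ z, H.dist x (R z) ≤ 1 + H.dist w (R z) := fun z => by
      rw [← hxw]; exact hH.dist_triangle
    rw [Walk.length_cons]
    by_cases hw : w ∈ E
    · obtain ⟨z, hz, hd⟩ := ih hw hy
      exact ⟨z, hz, by have := tri z; omega⟩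
    · obtain ⟨z, hz⟩ := exists_dist_le_of_notMem_farSet fun hwU => hw (hE.closed x hx w hwU h)
      have := tri z
      exact ⟨z, ⟨x, hx, by omega⟩, by omega⟩

/-- The vertices lying roughly between `R p` and `R q`: in a component attached to `R` only
between these indices, or near a vertex of `R` between them. -/
def located (H : SimpleGraph V) (R : ℕ → V) (p q : ℕ) : Set V :=
  {u | (∃ E, IsComponentOf H (farSet H R 10) E ∧ (∀ z, Attached H R E z → p ≤ z ∧ z ≤ q) ∧ u ∈ E) ∨
    ∃ z, p ≤ z ∧ z ≤ q ∧ H.dist u (R z) ≤ 34}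

theorem located_mono (hp : p' ≤ p) (hq : q ≤ q') : located H R p q ⊆ located H R p' q' := by
  rintro u (⟨E, hE, hz, hu⟩ | ⟨z, hpz, hzq, hd⟩)
  · exact .inl ⟨E, hE, fun z h => ⟨hp.trans (hz z h).1, (hz z h).2.trans hq⟩, hu⟩
  · exact .inr ⟨z, hp.trans hpz, hzq.trans hq, hd⟩

theorem mem_located_self (z : ℕ) : R z ∈ located H R z z := .inr ⟨z, le_rfl, le_rfl, by simp⟩

theorem bridge_subset_located (hH : H.Connected) (hE : IsComponentOf H (farSet H R 10) E)
    (hpq : ∀ z, Attached H R E z → p ≤ z ∧ z ≤ q) (hEF : Disjoint E F) (hδ : δ ≤ 12) :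
    bridge H E F δ ⊆ located H R p q := by
  rintro u ⟨x, hx, y, hy, hd⟩
  obtain ⟨z, hz, hzd⟩ := hE.exists_attached hH hx (Set.disjoint_right.1 hEF hy)
  have := hH.dist_triangle (u := x) (v := u) (w := y)
  have := hH.dist_triangle (u := u) (v := x) (w := R z)
  have := H.dist_comm (u := u) (v := x)
  exact .inr ⟨z, (hpq z hz).1, (hpq z hz).2, by omega⟩

theorem bridge_singleton_subset_located : bridge H E {R z} 11 ⊆ located H R z z := by
  rintro u ⟨x, -, _, rfl, hd⟩
  exact .inr ⟨z, le_rfl, le_rfl, by omega⟩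

theorem exists_dist_le_add_of_mem_located (hH : H.Connected) (hu : u ∈ located H R p q) (y : ℕ) :
    ∃ z, p ≤ z ∧ z ≤ q ∧ H.dist u (R z) ≤ H.dist u (R y) + 34 := by
  rcases hu with ⟨E, hE, hpq, hu⟩ | ⟨z, hpz, hzq, hd⟩
  · obtain ⟨z, hz, hd⟩ :=
      hE.exists_attached hH hu (y := R y) fun h => notMem_farSet_self 10 y (hE.subset h)
    exact ⟨z, (hpq z hz).1, (hpq z hz).2, by omega⟩
  · exact ⟨z, hpz, hzq, by omega⟩

theorem exists_near_of_mem_located (hH : H.Connected) (hu : u ∈ located H R p q)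
    (hw : w ∈ located H R p' q') (hqp : q < p') (huw : H.dist u w ≤ 3) :
    (∃ z, p ≤ z ∧ z ≤ q ∧ H.dist u (R z) ≤ 34) ∨ ∃ z, p' ≤ z ∧ z ≤ q' ∧ H.dist w (R z) ≤ 34 := by
  rcases hu with ⟨E, hE, hpqE, huE⟩ | hu
  swap
  · exact .inl hu
  rcases hw with ⟨F, hF, hpqF, hwF⟩ | hw
  swap
  · exact .inr hw
  have huF : u ∉ F := fun huF => by
    obtain ⟨z, hz, -⟩ := hE.exists_attached hH huE (y := R 0) fun h =>
      notMem_farSet_self 10 0 (hE.subset h)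
    have := (hpqE z hz).2
    have := (hpqF z (hE.eq_of_mem hF huE huF ▸ hz)).1
    omega
  obtain ⟨z, hz, hd⟩ := hF.exists_attached hH hwF huF
  rw [SimpleGraph.dist_comm (u := w) (v := u)] at hd
  exact .inr ⟨z, (hpqF z hz).1, (hpqF z hz).2, by omega⟩

theorem apart_located (hH : H.Connected) (hR : IsGeodesicRay H R) (hqp : q + 200 ≤ p') :
    Apart H 3 (located H R p q) (located H R p' q') := by
  intro u hu w hw
  by_contra! huw
  have hwu := huw
  rw [SimpleGraph.dist_comm] at hwu
  have near : ∀ z y, z ≤ q → p' ≤ y → H.dist u (R z) + H.dist w (R y) ≤ 106 → False := by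
    intro z y hz hy hd
    have := hR z y (by omega)
    have := hH.dist_triangle (u := R z) (v := u) (w := R y)
    have := hH.dist_triangle (u := u) (v := w) (w := R y)
    have := H.dist_comm (u := R z) (v := u)
    omega
  rcases exists_near_of_mem_located hH hu hw (by omega) huw with
    ⟨z, -, hz, hd⟩ | ⟨y, hy, -, hd⟩
  · obtain ⟨y, hy, -, hd'⟩ := exists_dist_le_add_of_mem_located hH hw z
    have := hH.dist_triangle (u := w) (v := u) (w := R z)
    exact near z y hz hy (by omega)
  · obtain ⟨z, -, hz, hd'⟩ := exists_dist_le_add_of_mem_located hH hu y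
    have := hH.dist_triangle (u := u) (v := w) (w := R y)
    exact near z y hz hy (by omega)

/-- A component of the vertices far from `R`, with its first attachment `a` and its last one
`b`. -/
structure IsJump (H : SimpleGraph V) (R : ℕ → V) (E : Set V) (a b : ℕ) : Prop where
  isComponentOf : IsComponentOf H (farSet H R 10) E
  attached_left : Attached H R E a
  attached_right : Attached H R E b
  mem_bounds : ∀ z, Attached H R E z → a ≤ z ∧ z ≤ b

theorem IsJump.disjoint (h : IsJump H R E a b) (h' : IsJump H R F a' b') (hb : b ≠ b') :
    Disjoint E F := by
  refine Set.disjoint_left.2 fun w hw hw' => hb ?_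
  obtain rfl := h.isComponentOf.eq_of_mem h'.isComponentOf hw hw'
  exact (h'.mem_bounds b h.attached_right).2.antisymm (h.mem_bounds b' h'.attached_right).2

theorem IsJump.subset_located (h : IsJump H R E a b) : E ⊆ located H R a b :=
  fun _ hu => .inl ⟨E, h.isComponentOf, h.mem_bounds, hu⟩

theorem IsJump.apart (h : IsJump H R E a b) (z : ℕ) : Apart H 10 E {R z} := by
  rintro u hu _ rfl
  exact h.isComponentOf.subset hu z

end Components

/-- Two sequences of indices that increase by at least `200` in each step, the first overtaking the
second within three steps. -/
structure Interlaced (a b : ℕ → ℕ) : Prop where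
  a_succ : ∀ k, a k + 200 ≤ a (k + 1)
  b_succ : ∀ k, b k + 200 ≤ b (k + 1)
  b_le_a : ∀ k, b k + 200 ≤ a (k + 3)

namespace Interlaced

variable {a b : ℕ → ℕ} {i j : ℕ}

theorem a_mono (h : Interlaced a b) : Monotone a :=
  monotone_nat_of_le_succ fun k => by have := h.a_succ k; omega

theorem b_mono (h : Interlaced a b) : Monotone b :=
  monotone_nat_of_le_succ fun k => by have := h.b_succ k; omega

theorem a_lt (h : Interlaced a b) (hij : i < j) : a i + 200 ≤ a j :=
  (h.a_succ i).trans (h.a_mono hij)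

theorem b_lt (h : Interlaced a b) (hij : i < j) : b i + 200 ≤ b j :=
  (h.b_succ i).trans (h.b_mono hij)

theorem b_lt_a (h : Interlaced a b) (hij : i + 3 ≤ j) : b i + 200 ≤ a j :=
  (h.b_le_a i).trans (h.a_mono hij)

theorem le_a (h : Interlaced a b) (k : ℕ) : k ≤ a k := by
  induction k with
  | zero => exact Nat.zero_le _
  | succ k ih => have := h.a_succ k; omega

theorem le_b (h : Interlaced a b) (k : ℕ) : k ≤ b k := by
  induction k with
  | zero => exact Nat.zero_le _
  | succ k ih => have := h.b_succ k; omega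

theorem comp (h : Interlaced a b) {f g : ℕ → ℕ} (hf : StrictMono f) (hg : StrictMono g)
    (hgf : ∀ i, g i + 3 ≤ f (i + 3)) : Interlaced (a ∘ f) (b ∘ g) where
  a_succ i := h.a_lt (hf i.lt_succ_self)
  b_succ i := h.b_lt (hg i.lt_succ_self)
  b_le_a i := h.b_lt_a (hgf i)

end Interlaced

/-- A sequence of components of the vertices far from `R`, the `k`th one jumping over the indices
from `a k` to `b k`. Consecutive ones overlap or are within distance `δ k` of each other; those two
steps apart are far from each other, along `R` or in the graph. The two levels of closeness, `6`
and `12`, leave room for paths of length at most `6` that stay far from the next component but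
one. -/
structure JumpChain {V : Type*} (H : SimpleGraph V) (R : ℕ → V) where
  E : ℕ → Set V
  a : ℕ → ℕ
  b : ℕ → ℕ
  δ : ℕ → ℕ
  isJump : ∀ k, IsJump H R (E k) (a k) (b k)
  interlaced : Interlaced a b
  δ_le : ∀ k, δ k ≤ 12
  sep_two : ∀ k, b k + 200 ≤ a (k + 2) ∨ Apart H 12 (E k) (E (k + 2)) ∧ δ k ≤ 6 ∧ δ (k + 1) ≤ 6
  break_or_link : ∀ k, Apart H 6 (E k) (E (k + 1)) ∧ a (k + 1) + 200 ≤ b k ∨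
    ∃ x ∈ E k, ∃ y ∈ E (k + 1), H.dist x y ≤ δ k

namespace JumpChain

variable {V : Type*} {H : SimpleGraph V} {R : ℕ → V} (C : JumpChain H R)

/-- At a break the two routes along `R` may swap roles: the next component is far from the `k`th
one, and starts before that one ends. -/
def IsBreak (k : ℕ) : Prop := Apart H 6 (C.E k) (C.E (k + 1)) ∧ C.a (k + 1) + 200 ≤ C.b k

/-- The short paths between two consecutive components. -/
def link (k : ℕ) : Set V := bridge H (C.E k) (C.E (k + 1)) (C.δ k)

/-- The short paths between the first attachment of the `k`th component and the component. -/
def entry (k : ℕ) : Set V := bridge H (C.E k) {R (C.a k)} 11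

/-- The short paths between the `k`th component and its last attachment. -/
def exit (k : ℕ) : Set V := bridge H (C.E k) {R (C.b k)} 11

/-- The components from the `f`th to the `g`th with the links between them. -/
def body (f g : ℕ) : Set V :=
  {u | (∃ k, f ≤ k ∧ k ≤ g ∧ u ∈ C.E k) ∨ ∃ k, f ≤ k ∧ k < g ∧ u ∈ C.link k}

/-- The components from the `f`th to the `g`th with the links between them, with paths to the
first and to the last attachment. -/
def run (f g : ℕ) : Set V := C.entry f ∪ C.body f g ∪ C.exit g

section Location

variable {f g : ℕ}

theorem a_le_b (k : ℕ) : C.a k ≤ C.b k :=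
  ((C.isJump k).mem_bounds _ (C.isJump k).attached_left).2

theorem disjoint_succ (k : ℕ) : Disjoint (C.E k) (C.E (k + 1)) :=
  (C.isJump k).disjoint (C.isJump (k + 1)) (by have := C.interlaced.b_succ k; omega)

theorem entry_subset_located (k : ℕ) : C.entry k ⊆ located H R (C.a k) (C.a k) :=
  bridge_singleton_subset_located

theorem exit_subset_located (k : ℕ) : C.exit k ⊆ located H R (C.b k) (C.b k) :=
  bridge_singleton_subset_located

theorem link_subset_located_left (hH : H.Connected) (k : ℕ) :
    C.link k ⊆ located H R (C.a k) (C.b k) :=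
  bridge_subset_located hH (C.isJump k).isComponentOf (C.isJump k).mem_bounds
    (C.disjoint_succ k) (C.δ_le k)

theorem link_subset_located_right (hH : H.Connected) (k : ℕ) :
    C.link k ⊆ located H R (C.a (k + 1)) (C.b (k + 1)) := by
  rw [link, bridge_comm]
  exact bridge_subset_located hH (C.isJump (k + 1)).isComponentOf (C.isJump (k + 1)).mem_bounds
    (C.disjoint_succ k).symm (C.δ_le k)

theorem run_subset_located (hH : H.Connected) (hfg : f ≤ g) :
    C.run f g ⊆ located H R (C.a f) (C.b g) := by
  have hab := (C.a_le_b f).trans (C.interlaced.b_mono hfg)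
  have hloc : ∀ k, f ≤ k → k ≤ g → located H R (C.a k) (C.b k) ⊆ located H R (C.a f) (C.b g) :=
    fun k hfk hkg => located_mono (C.interlaced.a_mono hfk) (C.interlaced.b_mono hkg)
  rintro u ((hu | ⟨k, hfk, hkg, hu⟩ | ⟨k, hfk, hkg, hu⟩) | hu)
  · exact located_mono le_rfl hab (C.entry_subset_located f hu)
  · exact hloc k hfk hkg ((C.isJump k).subset_located hu)
  · exact hloc k hfk hkg.le (C.link_subset_located_left hH k hu)
  · exact located_mono hab le_rfl (C.exit_subset_located g hu)

theorem run_cases_of_left {u : V} (hu : u ∈ C.run f g) :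
    u ∈ C.entry f ∨ (∃ k, f ≤ k ∧ k < g ∧ u ∈ C.E k ∪ C.link k) ∨ u ∈ C.E g ∪ C.exit g := by
  rcases hu with (hu | ⟨k, hfk, hkg, hu⟩ | ⟨k, hfk, hkg, hu⟩) | hu
  · exact .inl hu
  · obtain rfl | hlt := hkg.eq_or_lt
    · exact .inr (.inr (.inl hu))
    · exact .inr (.inl ⟨k, hfk, hlt, .inl hu⟩)
  · exact .inr (.inl ⟨k, hfk, hkg, .inr hu⟩)
  · exact .inr (.inr (.inr hu))

theorem run_cases_of_right {u : V} (hu : u ∈ C.run f g) :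
    u ∈ C.exit g ∨ (∃ k, f ≤ k ∧ k < g ∧ u ∈ C.E (k + 1) ∪ C.link k) ∨
      u ∈ C.E f ∪ C.entry f := by
  rcases hu with (hu | ⟨k, hfk, hkg, hu⟩ | ⟨k, hfk, hkg, hu⟩) | hu
  · exact .inr (.inr (.inr hu))
  · obtain rfl | hlt := hfk.eq_or_lt
    · exact .inr (.inr (.inl hu))
    · obtain ⟨n, rfl⟩ := Nat.exists_eq_succ_of_ne_zero (Nat.ne_zero_of_lt hlt)
      exact .inr (.inl ⟨n, by omega, by omega, .inl hu⟩)
  · exact .inr (.inl ⟨k, hfk, hkg, .inr hu⟩)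
  · exact .inl hu

end Location

section Separation

variable {f g f' g' k : ℕ}

theorem apart_of_isBreak (hH : H.Connected) (hR : IsGeodesicRay H R) (hk : C.IsBreak k) :
    Apart H 3 (C.E k ∪ C.exit k) (C.E (k + 1) ∪ C.entry (k + 1)) := by
  have hself : ∀ l, C.E l ⊆ bridge H (C.E l) (C.E l) 0 := fun _ => subset_bridge_self
  have hE : Apart H 3 (C.E k) (C.E (k + 1)) := hk.1.of_le (by omega)
  have hE_entry : Apart H 3 (C.E k) (C.entry (k + 1)) :=
    (Apart.bridge hH hk.1 ((C.isJump k).apart _) (by omega)).mono (hself k) subset_rfl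
  have hexit_E : Apart H 3 (C.exit k) (C.E (k + 1)) :=
    (Apart.bridge hH hk.1 ((C.isJump (k + 1)).apart _).symm (by omega)).mono subset_rfl
      (hself (k + 1))
  have hexit_entry : Apart H 3 (C.exit k) (C.entry (k + 1)) :=
    ((apart_located hH hR hk.2).mono (C.entry_subset_located _) (C.exit_subset_located _)).symm
  exact (hE.union_right hE_entry).union_left (hexit_E.union_right hexit_entry)

theorem apart_entry_add_two (hH : H.Connected) (hR : IsGeodesicRay H R) (k : ℕ) :
    Apart H 3 (C.E k ∪ C.link k) (C.E (k + 2) ∪ C.entry (k + 2)) := by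
  rcases C.sep_two k with hab | ⟨hE, hδ, -⟩
  · refine (apart_located hH hR hab).mono
      (Set.union_subset (C.isJump k).subset_located (C.link_subset_located_left hH k))
      (Set.union_subset (C.isJump _).subset_located ?_)
    exact (C.entry_subset_located _).trans (located_mono le_rfl (C.a_le_b _))
  · have hE_entry : Apart H 3 (C.E k) (C.entry (k + 2)) :=
      (Apart.bridge hH hE ((C.isJump k).apart _) (by omega)).mono subset_bridge_self subset_rfl
    have hlink_E : Apart H 3 (C.link k) (C.E (k + 2)) := hE.bridge_left hH (by omega)
    have hlink_entry : Apart H 3 (C.link k) (C.entry (k + 2)) :=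
      Apart.bridge hH hE ((C.isJump (k + 1)).apart _) (by omega)
    exact ((hE.of_le (by omega)).union_right hE_entry).union_left
      (hlink_E.union_right hlink_entry)

theorem apart_exit_add_two (hH : H.Connected) (hR : IsGeodesicRay H R) (k : ℕ) :
    Apart H 3 (C.E k ∪ C.exit k) (C.E (k + 2) ∪ C.link (k + 1)) := by
  rcases C.sep_two k with hab | ⟨hE, -, hδ⟩
  · refine (apart_located hH hR hab).mono (Set.union_subset (C.isJump k).subset_located ?_)
      (Set.union_subset (C.isJump _).subset_located (C.link_subset_located_right hH (k + 1)))
    exact (C.exit_subset_located _).trans (located_mono (C.a_le_b _) le_rfl)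
  · have hlink : C.link (k + 1) = bridge H (C.E (k + 2)) (C.E (k + 1)) (C.δ (k + 1)) :=
      bridge_comm _ _ _
    have hE_link : Apart H 3 (C.E k) (C.link (k + 1)) := by
      rw [hlink]
      exact (hE.symm.bridge_left hH (by omega)).symm
    have hexit_E : Apart H 3 (C.exit k) (C.E (k + 2)) :=
      (Apart.bridge hH hE ((C.isJump (k + 2)).apart _).symm (by omega)).mono subset_rfl
        subset_bridge_self
    have hexit_link : Apart H 3 (C.exit k) (C.link (k + 1)) := by
      rw [hlink]
      exact Apart.bridge hH hE ((C.isJump (k + 1)).apart _).symm (by omega)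
    exact ((hE.of_le (by omega)).union_right hE_link).union_left
      (hexit_E.union_right hexit_link)

theorem apart_run_succ (hH : H.Connected) (hR : IsGeodesicRay H R) (hg : C.IsBreak g)
    (hfg : f ≤ g) (hgg' : g + 1 ≤ g') : Apart H 3 (C.run f g) (C.run (g + 1) g') := by
  have hC := C.interlaced
  have hleft : ∀ k, C.E k ∪ C.link k ⊆ located H R (C.a k) (C.b k) := fun k =>
    Set.union_subset (C.isJump k).subset_located (C.link_subset_located_left hH k)
  have hright : ∀ k, C.E (k + 1) ∪ C.link k ⊆ located H R (C.a (k + 1)) (C.b (k + 1)) := fun k =>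
    Set.union_subset (C.isJump (k + 1)).subset_located (C.link_subset_located_right hH k)
  have hexit : Apart H 3 (C.run f g) (C.exit g') :=
    (apart_located hH hR (hC.b_lt hgg')).mono (C.run_subset_located hH hfg)
      (C.exit_subset_located g')
  intro u hu w hw
  rcases C.run_cases_of_left hu with hu' | ⟨k, -, hkg, hu'⟩ | hu'
  · exact apart_located hH hR (hC.a_lt (by omega)) u (C.entry_subset_located f hu') w
      (C.run_subset_located hH hgg' hw)
  all_goals rcases C.run_cases_of_right hw with hw' | ⟨l, hgl, -, hw'⟩ | hw'
  · exact hexit u hu w hw'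
  · exact apart_located hH hR (hC.b_lt_a (by omega)) u (hleft k hu') w (hright l hw')
  · obtain rfl | hkg := Nat.eq_or_lt_of_le hkg
    · exact C.apart_entry_add_two hH hR k u hu' w hw'
    · have hw'' := C.run_subset_located hH hgg' hw
      exact apart_located hH hR (hC.b_lt_a (by omega)) u (hleft k hu') w hw''
  · exact hexit u hu w hw'
  · obtain rfl | hgl := Nat.eq_or_lt_of_le hgl
    · exact C.apart_exit_add_two hH hR g u hu' w hw'
    · exact apart_located hH hR (hC.b_lt_a (by omega)) u (C.run_subset_located hH hfg hu) w
        (hright l hw')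
  · exact C.apart_of_isBreak hH hR hg u hu' w hw'

theorem apart_run (hH : H.Connected) (hR : IsGeodesicRay H R) (hg : C.IsBreak g) (hfg : f ≤ g)
    (hfg' : f' ≤ g') (hgf : f' = g + 1 ∨ g + 3 ≤ f') :
    Apart H 3 (C.run f g) (C.run f' g') := by
  rcases hgf with rfl | hgf
  · exact C.apart_run_succ hH hR hg hfg hfg'
  · exact (apart_located hH hR (C.interlaced.b_lt_a hgf)).mono (C.run_subset_located hH hfg)
      (C.run_subset_located hH hfg')

theorem body_subset_farSet (hH : H.Connected) (f g : ℕ) : C.body f g ⊆ farSet H R 3 := by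
  rintro u (⟨k, -, -, hu⟩ | ⟨k, -, -, hu⟩) z
  · have := (C.isJump k).isComponentOf.subset hu z
    omega
  · refine Apart.bridge (Y' := {R z}) hH ((C.isJump k).apart z) ((C.isJump (k + 1)).apart z) ?_
      u hu (R z) (subset_bridge_self rfl)
    have := C.δ_le k
    omega

theorem lt_dist_of_mem_run (hH : H.Connected) (hR : IsGeodesicRay H R) {z : ℕ}
    (ha : z + 200 ≤ C.a f ∨ C.a f + 200 ≤ z) (hb : z + 200 ≤ C.b g ∨ C.b g + 200 ≤ z) {u : V}
    (hu : u ∈ C.run f g) : 3 < H.dist u (R z) := by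
  have key : ∀ y, z + 200 ≤ y ∨ y + 200 ≤ z → u ∈ located H R y y → 3 < H.dist u (R z) := by
    rintro y (h | h) hu
    · rw [SimpleGraph.dist_comm]
      exact apart_located hH hR h _ (mem_located_self z) u hu
    · exact apart_located hH hR h u hu _ (mem_located_self z)
  rcases hu with (hu | hu) | hu
  · exact key _ ha (C.entry_subset_located f hu)
  · exact C.body_subset_farSet hH f g hu z
  · exact key _ hb (C.exit_subset_located g hu)

end Separation

section Connectedness

variable {f g : ℕ}

theorem connectedOn_body (hH : H.Connected) (hfg : f ≤ g)
    (hlink : ∀ k, f ≤ k → k < g → ¬ C.IsBreak k) : ConnectedOn H (C.body f g) := by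
  induction g, hfg using Nat.le_induction with
  | base =>
    have hbody : C.body f f = C.E f := by
      ext u
      constructor
      · rintro (⟨k, hfk, hkf, hu⟩ | ⟨k, hfk, hkf, -⟩)
        · rwa [hfk.antisymm hkf]
        · omega
      · exact fun hu => .inl ⟨f, le_rfl, le_rfl, hu⟩
    rw [hbody]
    exact (C.isJump f).isComponentOf.connectedOn
  | succ g hfg ih =>
    have hbody : C.body f (g + 1) = C.body f g ∪ C.link g ∪ C.E (g + 1) := by
      ext u
      constructor
      · rintro (⟨k, hfk, hkg, hu⟩ | ⟨k, hfk, hkg, hu⟩)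
        · obtain rfl | hlt := hkg.eq_or_lt
          · exact .inr hu
          · exact .inl (.inl (.inl ⟨k, hfk, by omega, hu⟩))
        · obtain rfl | hlt := (Nat.lt_succ_iff.1 hkg).eq_or_lt
          · exact .inl (.inr hu)
          · exact .inl (.inl (.inr ⟨k, hfk, hlt, hu⟩))
      · rintro (((⟨k, hfk, hkg, hu⟩ | ⟨k, hfk, hkg, hu⟩) | hu) | hu)
        · exact .inl ⟨k, hfk, by omega, hu⟩
        · exact .inr ⟨k, hfk, by omega, hu⟩
        · exact .inr ⟨g, hfg, by omega, hu⟩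
        · exact .inl ⟨g + 1, by omega, le_rfl, hu⟩
    obtain ⟨x, hx, y, hy, hd⟩ := (C.break_or_link g).resolve_left (hlink g hfg g.lt_succ_self)
    rw [hbody]
    refine ((ih fun k hfk hkg => hlink k hfk (hkg.trans g.lt_succ_self)).union_bridge hH
      fun u hu => .inl ⟨g, hfg, le_rfl, hu⟩).union (C.isJump (g + 1)).isComponentOf.connectedOn
      (.inr (mem_bridge_right hx hy hd)) hy

theorem connectedOn_run (hH : H.Connected) (hfg : f ≤ g)
    (hlink : ∀ k, f ≤ k → k < g → ¬ C.IsBreak k) : ConnectedOn H (C.run f g) := by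
  rw [run, Set.union_comm (C.entry f)]
  refine ((C.connectedOn_body hH hfg hlink).union_bridge hH fun u hu => ?_).union_bridge hH
    fun u hu => ?_
  · exact .inl ⟨f, le_rfl, hfg, hu⟩
  · exact .inl (.inl ⟨g, hfg, le_rfl, hu⟩)

theorem mem_run_a (f g : ℕ) : R (C.a f) ∈ C.run f g := by
  obtain ⟨x, hx, hd⟩ := (C.isJump f).attached_left
  exact .inl (.inl (mem_bridge_right hx rfl hd))

theorem mem_run_b (f g : ℕ) : R (C.b g) ∈ C.run f g := by
  obtain ⟨x, hx, hd⟩ := (C.isJump g).attached_right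
  exact .inr (mem_bridge_right hx rfl hd)

theorem exists_attached_ge_of_forall_not_isBreak (hH : H.Connected)
    (hf : ∀ k, f ≤ k → ¬ C.IsBreak k) :
    ∃ S ⊆ farSet H R 3, ConnectedOn H S ∧ ∀ n, ∃ z, n ≤ z ∧ Attached H R S z := by
  refine ⟨⋃ n, C.body f (f + n), Set.iUnion_subset fun n => C.body_subset_farSet hH _ _,
    ConnectedOn.iUnion_seq (fun n => C.connectedOn_body hH (f.le_add_right n) fun k hfk _ =>
      hf k hfk) fun n => ?_, fun n => ?_⟩
  · obtain ⟨x, hx, -⟩ := (C.isJump f).attached_left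
    exact ⟨x, .inl ⟨f, le_rfl, by omega, hx⟩, .inl ⟨f, le_rfl, by omega, hx⟩⟩
  · obtain ⟨x, hx, hd⟩ := (C.isJump (f + n)).attached_right
    exact ⟨_, (n.le_add_left f).trans (C.interlaced.le_b _), x,
      Set.mem_iUnion.2 ⟨n, .inl ⟨f + n, f.le_add_right n, le_rfl, hx⟩⟩, hd⟩

end Connectedness

end JumpChain

/-- The vertices of `R` with index between `i` and `j`, in either order. -/
def segment {V : Type*} (R : ℕ → V) (i j : ℕ) : Set V := R '' Set.uIcc i j

theorem connectedOn_segment {V : Type*} {H : SimpleGraph V} {R : ℕ → V}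
    (hadj : ∀ n, H.Adj (R n) (R (n + 1))) (i j : ℕ) : ConnectedOn H (segment R i j) := by
  refine connectedOn_of_reachableIn (x := R (min i j)) ?_
  rintro _ ⟨z, hz, rfl⟩
  exact .of_seq hz.1 (fun n _ _ => hadj n) fun n hn hnz => ⟨n, ⟨hn, hnz.trans hz.2⟩, rfl⟩

/-- Connected sets `S i`, joining `R (α i)` to `R (β i)`, from which two routes along `R` can be
built: one follows the sets of even index, the other those of odd index, each taking `R` from one
of its sets to the next. -/
structure Blocks {V : Type*} (H : SimpleGraph V) (R : ℕ → V) where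
  S : ℕ → Set V
  α : ℕ → ℕ
  β : ℕ → ℕ
  interlaced : Interlaced α β
  overlap : ∀ i, α (i + 1) + 200 ≤ β i
  connectedOn : ∀ i, ConnectedOn H (S i)
  mem_α : ∀ i, R (α i) ∈ S i
  mem_β : ∀ i, R (β i) ∈ S i
  apart : ∀ i j, j = i + 1 ∨ i + 3 ≤ j → Apart H 3 (S i) (S j)
  lt_dist : ∀ i z, z + 200 ≤ α i ∨ α i + 200 ≤ z → z + 200 ≤ β i ∨ β i + 200 ≤ z →
    ∀ u ∈ S i, 3 < H.dist u (R z)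

namespace Blocks

variable {V : Type*} {H : SimpleGraph V} {R : ℕ → V} (B : Blocks H R) {i j : ℕ}

/-- The part of `R` that leads from `S i` to `S (i + 2)`. -/
def seg (i : ℕ) : Set V := segment R (B.β i) (B.α (i + 2))

/-- The route through the sets `S p`, `S (p + 2)`, `S (p + 4)`, … -/
def route (p : ℕ) : Set V := ⋃ n, B.S (2 * n + p) ∪ B.seg (2 * n + p)

theorem apart_S_of_odd (hij : (i + j) % 2 = 1) : Apart H 3 (B.S i) (B.S j) := by
  rcases le_total i j with h | h
  · exact B.apart i j (by omega)
  · exact (B.apart j i (by omega)).symm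

theorem apart_S_seg (hij : (i + j) % 2 = 1) : Apart H 3 (B.S i) (B.seg j) := by
  rintro u hu _ ⟨z, hz, rfl⟩
  rw [Set.uIcc, Set.mem_Icc] at hz
  have hB := B.interlaced
  have := B.overlap j
  have : B.α (j + 2) + 200 ≤ B.β (j + 1) := B.overlap (j + 1)
  have := hB.a_lt (show j + 1 < j + 2 by omega)
  have := hB.b_succ j
  refine B.lt_dist i z ?_ ?_ u hu
  · rcases Nat.lt_or_ge (j + 1) i with h | h
    · have := hB.a_lt (show j + 2 < i by omega)
      have := hB.b_lt_a (show j + 3 ≤ i by omega)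
      omega
    · have := hB.a_mono h
      omega
  · rcases Nat.lt_or_ge j i with h | h
    · have := hB.b_mono (show j + 1 ≤ i from h)
      omega
    · have := hB.b_lt (show i < j by omega)
      have := hB.b_lt_a (show i + 3 ≤ j + 2 by omega)
      omega

theorem apart_seg (hR : IsGeodesicRay H R) (hij : i < j) : Apart H 3 (B.seg i) (B.seg j) := by
  rintro _ ⟨z, hz, rfl⟩ _ ⟨y, hy, rfl⟩
  rw [Set.uIcc, Set.mem_Icc] at hz hy
  have hB := B.interlaced
  have := hB.b_lt hij
  have := hB.b_lt_a (show i + 3 ≤ j + 2 by omega)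
  have : B.α (i + 2) + 200 ≤ B.β (i + 1) := B.overlap (i + 1)
  have := hB.b_mono (show i + 1 ≤ j from hij)
  have := hB.a_lt (show i + 2 < j + 2 by omega)
  rw [hR z y (by omega)]
  omega

theorem apart_seg_of_odd (hR : IsGeodesicRay H R) (hij : (i + j) % 2 = 1) :
    Apart H 3 (B.seg i) (B.seg j) := by
  rcases le_total i j with h | h
  · exact B.apart_seg hR (by omega)
  · exact (B.apart_seg hR (by omega)).symm

theorem apart_route (hR : IsGeodesicRay H R) : Apart H 3 (B.route 0) (B.route 1) :=
  .iUnion fun i j =>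
    ((B.apart_S_of_odd (by omega)).union_right (B.apart_S_seg (by omega))).union_left
      ((B.apart_S_seg (by omega)).symm.union_right (B.apart_seg_of_odd hR (by omega)))

theorem connectedOn_route (hR : IsGeodesicRay H R) (p : ℕ) : ConnectedOn H (B.route p) := by
  refine ConnectedOn.iUnion_seq (fun n => ?_) fun n => ?_
  · exact (B.connectedOn _).union (connectedOn_segment hR.adj _ _) (B.mem_β _)
      ⟨_, Set.left_mem_uIcc, rfl⟩
  · rw [show 2 * (n + 1) + p = 2 * n + p + 2 by omega]
    exact ⟨_, .inr ⟨_, Set.right_mem_uIcc, rfl⟩, .inl (B.mem_α _)⟩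

theorem exists_attached_route (p n : ℕ) : ∃ z, n ≤ z ∧ Attached H R (B.route p) z := by
  have := B.interlaced.le_a (2 * n + p)
  exact ⟨B.α (2 * n + p), by omega,
    attached_of_mem (Set.mem_iUnion.2 ⟨n, .inl (B.mem_α _)⟩)⟩

end Blocks

namespace JumpChain

variable {V : Type*} {H : SimpleGraph V} {R : ℕ → V} (C : JumpChain H R)

/-- The `i`th block of a chain consists of its members between two consecutive breaks. -/
noncomputable def blocks (hH : H.Connected) (hR : IsGeodesicRay H R)
    (hbreak : {k | C.IsBreak k}.Infinite) : Blocks H R :=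
  let f i := Nat.nth C.IsBreak i + 1
  let g i := Nat.nth C.IsBreak (i + 1)
  have hmono := Nat.nth_strictMono hbreak
  have hg : ∀ i, C.IsBreak (g i) := fun i => Nat.nth_mem_of_infinite hbreak _
  have hfg : ∀ i, f i ≤ g i := fun i => hmono i.lt_succ_self
  have hgf : ∀ i j, i + 3 ≤ j → g i + 3 ≤ f j := fun i j hij => by
    have h₁ : g i < Nat.nth C.IsBreak (i + 2) := hmono (by omega)
    have h₂ : Nat.nth C.IsBreak (i + 2) < Nat.nth C.IsBreak j := hmono (by omega)
    change g i + 3 ≤ Nat.nth C.IsBreak j + 1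
    omega
  { S i := C.run (f i) (g i)
    α := C.a ∘ f
    β := C.b ∘ g
    interlaced := C.interlaced.comp (fun _ _ h => Nat.succ_lt_succ (hmono h))
      (fun _ _ h => hmono (Nat.succ_lt_succ h)) fun i => hgf i _ le_rfl
    overlap i := (hg i).2
    connectedOn i := C.connectedOn_run hH (hfg i) fun k hfk hkg hk =>
      (Nat.le_nth_of_lt_nth_succ hkg hk).not_gt hfk
    mem_α i := C.mem_run_a _ _
    mem_β i := C.mem_run_b _ _
    apart i j hij := C.apart_run hH hR (hg i) (hfg i) (hfg j)
      (hij.imp (fun h => by rw [h]) (hgf i j))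
    lt_dist i z hα hβ u hu := C.lt_dist_of_mem_run hH hR hα hβ hu }

end JumpChain

section Jumps

variable {V : Type*} {H : SimpleGraph V} {R : ℕ → V} {i p : ℕ} {u v : V}

/-- Some component of the vertices far from `R` is attached both well before and well after the
index `i`. -/
def JumpedOver (H : SimpleGraph V) (R : ℕ → V) (i : ℕ) : Prop :=
  ∃ E, IsComponentOf H (farSet H R 10) E ∧
    (∃ z, z + 1000 ≤ i ∧ Attached H R E z) ∧ ∃ z, i + 1000 ≤ z ∧ Attached H R E z

/-- The vertex `v` is close to the part of `R` before the index `i`, or in a component attached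
well before `i`. -/
def LeftOf (H : SimpleGraph V) (R : ℕ → V) (i : ℕ) (v : V) : Prop :=
  (∃ z, z ≤ i ∧ H.dist v (R z) ≤ 10) ∨
    ∃ E, IsComponentOf H (farSet H R 10) E ∧ v ∈ E ∧ ∃ z, z + 1000 ≤ i ∧ Attached H R E z

theorem IsGeodesicRay.outside_of_dist_le (hH : H.Connected) (hR : IsGeodesicRay H R)
    (hv : 1010 < H.dist (R i) v) {z : ℕ} (hz : H.dist v (R z) ≤ 10) :
    z + 1000 ≤ i ∨ i + 1000 ≤ z := by
  have htri := hH.dist_triangle (u := R i) (v := R z) (w := v)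
  rw [H.dist_comm (u := R z) (v := v)] at htri
  rcases le_total i z with h | h
  · rw [hR i z h] at htri
    omega
  · rw [H.dist_comm (u := R i) (v := R z), hR z i h] at htri
    omega

theorem LeftOf.of_adj (hH : H.Connected) (hR : IsGeodesicRay H R) (hi : ¬ JumpedOver H R i)
    (hu : 1010 < H.dist (R i) u) (hv : 1010 < H.dist (R i) v) (huv : H.Adj u v)
    (h : LeftOf H R i u) : LeftOf H R i v := by
  have hdist := dist_eq_one_iff_adj.2 huv
  by_cases hvU : v ∈ farSet H R 10
  · refine .inr ?_
    rcases h with ⟨z, hz, hd⟩ | ⟨E, hE, huE, hz⟩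
    · have hzi := hR.outside_of_dist_le hH hu hd
      have := hH.dist_triangle (u := v) (v := u) (w := R z)
      rw [H.dist_comm (u := v) (v := u)] at this
      exact ⟨_, isComponentOf_setOf_reachableIn _ v, .refl hvU, z, by omega, v, .refl hvU,
        by omega⟩
    · exact ⟨E, hE, hE.closed u huE v hvU huv, hz⟩
  · obtain ⟨z, hz⟩ := exists_dist_le_of_notMem_farSet hvU
    by_cases hzi : z ≤ i
    · exact .inl ⟨z, hzi, hz⟩
    have hiz := hR.outside_of_dist_le hH hv hz
    have huz := hH.dist_triangle (u := u) (v := v) (w := R z)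
    rcases h with ⟨y, hy, hd⟩ | ⟨E, hE, huE, hy⟩
    · have := hH.dist_triangle (u := R y) (v := u) (w := R z)
      rw [H.dist_comm (u := R y) (v := u), hR y z (by omega)] at this
      omega
    · exact absurd ⟨E, hE, hy, z, by omega, u, huE, by omega⟩ hi

theorem jumpedOver_of_reachableIn (hH : H.Connected) (hR : IsGeodesicRay H R) {l : ℕ}
    (hil : i < l) (h : ReachableIn H {v | 1010 < H.dist (R i) v} (R 0) (R l)) :
    JumpedOver H R i := by
  by_contra hi
  have hleft : LeftOf H R i (R l) := h.induct (P := LeftOf H R i)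
    (fun u v hu hv huv => LeftOf.of_adj hH hR hi hu hv huv) (.inl ⟨0, by omega, by simp⟩)
  rcases hleft with ⟨z, hz, hd⟩ | ⟨E, hE, hl, -⟩
  · have hil' : 1010 < H.dist (R i) (R l) := h.mem_right
    rw [hR i l hil.le] at hil'
    rw [SimpleGraph.dist_comm, hR z l (by omega)] at hd
    omega
  · exact notMem_farSet_self 10 l (hE.subset hl)

/-- The attachments of all components that are attached at `p` or before. -/
def reach (H : SimpleGraph V) (R : ℕ → V) (p : ℕ) : Set ℕ :=
  {z | ∃ E, IsComponentOf H (farSet H R 10) E ∧ (∃ y, y ≤ p ∧ Attached H R E y) ∧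
    Attached H R E z}

theorem bddAbove_reach (hH : H.Connected) (hfin : ∀ v, (H.neighborSet v).Finite)
    (hR : IsGeodesicRay H R)
    (hbdd : ∀ S ⊆ farSet H R 3, ConnectedOn H S → BddAbove {z | Attached H R S z}) (p : ℕ) :
    BddAbove (reach H R p) := by
  have hsub : farSet H R 10 ⊆ farSet H R 3 := fun v hv z => by have := hv z; omega
  have hcomp := fun x => isComponentOf_setOf_reachableIn (H := H) (farSet H R 10) x
  refine (((finite_dist_le hH hfin (R 0) (p + 11)).bddAbove_biUnion).2 fun x _ =>
    hbdd _ ((hcomp x).subset.trans hsub) (hcomp x).connectedOn).mono ?_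
  rintro z ⟨E, hE, ⟨y, hy, x, hx, hd⟩, w, hw, hd'⟩
  have := hH.dist_triangle (u := R 0) (v := R y) (w := x)
  rw [hR 0 y (by omega), H.dist_comm (u := R y)] at this
  exact Set.mem_biUnion (x := x) (show H.dist (R 0) x ≤ p + 11 by omega)
    ⟨w, (hE.connectedOn x hx w hw).mono hE.subset, hd'⟩

theorem exists_furthest_isJump (hH : H.Connected) (hfin : ∀ v, (H.neighborSet v).Finite)
    (hR : IsGeodesicRay H R)
    (hbdd : ∀ S ⊆ farSet H R 3, ConnectedOn H S → BddAbove {z | Attached H R S z})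
    (hp : JumpedOver H R (p + 1000)) :
    ∃ E a b, IsJump H R E a b ∧ a ≤ p ∧ p + 2000 ≤ b ∧
      ∀ E' a' b', IsJump H R E' a' b' → a' ≤ p → b' ≤ b := by
  classical
  have hbdd' := bddAbove_reach hH hfin hR hbdd p
  obtain ⟨E₀, hE₀, ⟨y₀, hy₀, hEy₀⟩, z₀, hz₀, hEz₀⟩ := hp
  have hz₀_mem : z₀ ∈ reach H R p := ⟨E₀, hE₀, ⟨y₀, by omega, hEy₀⟩, hEz₀⟩
  obtain ⟨E, hE, ⟨y, hy, hEy⟩, hEb⟩ := Nat.sSup_mem ⟨_, hz₀_mem⟩ hbdd'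
  have hex : ∃ a, Attached H R E a := ⟨y, hEy⟩
  refine ⟨E, Nat.find hex, _, ⟨hE, Nat.find_spec hex, hEb, fun z hz =>
    ⟨Nat.find_min' hex hz, le_csSup hbdd' ⟨E, hE, ⟨y, hy, hEy⟩, hz⟩⟩⟩,
    (Nat.find_min' hex hEy).trans hy, le_trans (by omega) (le_csSup hbdd' hz₀_mem),
    fun E' a' b' h ha' => le_csSup hbdd' ⟨E', h.isComponentOf, ⟨a', ha', h.attached_left⟩,
      h.attached_right⟩⟩

/-- Among three consecutive terms of `a` two are spaced out, so it suffices to skip some terms,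
never two in a row. -/
theorem exists_spaced_subsequence {a P : ℕ → ℕ} (haP : ∀ k, a k ≤ P k)
    (hPa : ∀ k, P k < a (k + 1)) (hP : ∀ k, P k + 1600 ≤ P (k + 1)) :
    ∃ g : ℕ → ℕ, StrictMono g ∧ (∀ k, a (g k) + 200 ≤ a (g (k + 1))) ∧
      ∀ k, a (g (k + 1)) ≤ P (g k + 1) + 200 := by
  let good n := a n + 200 ≤ a (n + 1)
  have hgood : ∀ n, good n ∨ good (n + 1) := fun n => by
    have := haP n
    have := hP n
    have := hPa (n + 1)
    simp only [good]
    omega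
  have hstep : ∀ n : {n // good n}, ∃ m : {n // good n}, n < m.1 ∧ a n + 200 ≤ a m ∧
      a m ≤ P (n + 1) + 200 := by
    rintro ⟨n, hn⟩
    by_cases hn' : good (n + 1)
    · exact ⟨⟨n + 1, hn'⟩, n.lt_succ_self, hn, le_add_right (haP _)⟩
    · refine ⟨⟨n + 2, (hgood (n + 1)).resolve_left hn'⟩, ?_⟩
      have := haP n
      have := haP (n + 1)
      have := hP n
      have : P (n + 1) < a (n + 2) := hPa (n + 1)
      have hclose : ¬ a (n + 1) + 200 ≤ a (n + 2) := hn'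
      exact ⟨show n < n + 2 by omega, show a n + 200 ≤ a (n + 2) by omega,
        show a (n + 2) ≤ P (n + 1) + 200 by omega⟩
  obtain ⟨n₀⟩ : Nonempty {n // good n} :=
    (hgood 0).elim (fun h => ⟨⟨_, h⟩⟩) fun h => ⟨⟨_, h⟩⟩
  choose f hlt hspaced hle using hstep
  have hf : ∀ k, f^[k + 1] n₀ = f (f^[k] n₀) := fun k => Function.iterate_succ_apply' f k n₀
  refine ⟨fun k => f^[k] n₀, strictMono_nat_of_lt_succ fun k => ?_, fun k => ?_, fun k => ?_⟩ <;>
    simp only [hf]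
  exacts [hlt _, hspaced _, hle _]

theorem exists_interlaced_subsequence {a b P : ℕ → ℕ} (haP : ∀ k, a k ≤ P k)
    (hPa : ∀ k, P k < a (k + 1)) (hP : ∀ k, P k + 1600 ≤ P (k + 1))
    (hb : ∀ k, b k = P (k + 1) + 400) :
    ∃ g : ℕ → ℕ, Interlaced (a ∘ g) (b ∘ g) ∧ ∀ k, a (g (k + 1)) + 200 ≤ b (g k) := by
  obtain ⟨g, hg, hspaced, hle⟩ := exists_spaced_subsequence haP hPa hP
  have hP_mono : Monotone P := monotone_nat_of_le_succ fun k => by have := hP k; omega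
  refine ⟨g, ⟨hspaced, fun k => ?_, fun k => ?_⟩, fun k => ?_⟩ <;>
    simp only [Function.comp_apply, hb]
  · have := hP (g (k + 1))
    have := hP_mono (show g k + 1 ≤ g (k + 1) from hg k.lt_succ_self)
    omega
  · have h₁ : g k < g (k + 1) := hg (by omega)
    have h₂ : g (k + 1) < g (k + 2) := hg (by omega)
    have h₃ : g (k + 2) < g (k + 3) := hg (by omega)
    obtain ⟨m, hm⟩ : ∃ m, g (k + 3) = m + 1 := ⟨g (k + 3) - 1, by omega⟩
    have : P (g k + 1) + 1600 ≤ P (g k + 2) := hP (g k + 1)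
    have := hP_mono (show g k + 2 ≤ m by omega)
    have := hPa m
    rw [hm]
    omega
  · have := hle k
    omega

theorem exists_overlapping_jumps (hH : H.Connected) (hfin : ∀ v, (H.neighborSet v).Finite)
    (hR : IsGeodesicRay H R)
    (hbdd : ∀ S ⊆ farSet H R 3, ConnectedOn H S → BddAbove {z | Attached H R S z}) {i₀ : ℕ}
    (hjump : ∀ i, i₀ ≤ i → JumpedOver H R i) :
    ∃ (E : ℕ → Set V) (a b : ℕ → ℕ), (∀ k, IsJump H R (E k) (a k) (b k)) ∧ Interlaced a b ∧
      ∀ k, a (k + 1) + 200 ≤ b k := by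
  choose! E a b hE hap hpb hmax using fun p (hp : i₀ ≤ p) =>
    exists_furthest_isJump hH hfin hR hbdd (p := p) (hjump (p + 1000) (by omega))
  let P k := (fun p => b p - 400)^[k] i₀
  have hP : ∀ k, P (k + 1) = b (P k) - 400 := fun k => Function.iterate_succ_apply' _ k i₀
  have hP₀ : ∀ k, i₀ ≤ P k := by
    intro k
    induction k with
    | zero => exact le_rfl
    | succ k ih => have := hpb _ ih; have := hP k; omega
  have hb : ∀ k, b (P k) = P (k + 1) + 400 := fun k => by
    have := hpb _ (hP₀ k); have := hP k; omega
  have hP_succ : ∀ k, P k + 1600 ≤ P (k + 1) := fun k => by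
    have := hpb _ (hP₀ k); have := hP k; omega
  have hPa : ∀ k, P k < a (P (k + 1)) := by
    intro k
    by_contra! hcon
    have := hmax _ (hP₀ k) _ _ _ (hE _ (hP₀ (k + 1))) hcon
    have := hb k
    have := hb (k + 1)
    have := hP_succ (k + 1)
    omega
  obtain ⟨g, hab, hoverlap⟩ := exists_interlaced_subsequence (a := a ∘ P) (b := b ∘ P)
    (fun k => hap _ (hP₀ k)) hPa hP_succ hb
  exact ⟨E ∘ P ∘ g, _, _, fun k => hE _ (hP₀ _), hab, hoverlap⟩

theorem exists_skipping_subsequence (skip : ℕ → Prop) :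
    ∃ n : ℕ → ℕ, StrictMono n ∧ (∀ t, skip (n t) → n (t + 1) = n t + 2) ∧
      ∀ t, ¬ skip (n t) → n (t + 1) = n t + 1 := by
  classical
  let next k := if skip k then k + 2 else k + 1
  have hn : ∀ t, next^[t + 1] 0 = next (next^[t] 0) := fun t => Function.iterate_succ_apply' _ t 0
  refine ⟨fun t => next^[t] 0, strictMono_nat_of_lt_succ fun t => ?_,
    fun t h => (hn t).trans (if_pos h), fun t h => (hn t).trans (if_neg h)⟩
  rw [hn]
  simp only [next]
  split_ifs <;> omega

theorem exists_jumpChain (hH : H.Connected) (hfin : ∀ v, (H.neighborSet v).Finite)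
    (hR : IsGeodesicRay H R)
    (hbdd : ∀ S ⊆ farSet H R 3, ConnectedOn H S → BddAbove {z | Attached H R S z}) {i₀ : ℕ}
    (hjump : ∀ i, i₀ ≤ i → JumpedOver H R i) : Nonempty (JumpChain H R) := by
  classical
  obtain ⟨E, a, b, hE, hab, hoverlap⟩ := exists_overlapping_jumps hH hfin hR hbdd hjump
  -- A jump is skipped if the jumps before and after it are close to each other.
  let close k := ∃ x ∈ E k, ∃ y ∈ E (k + 2), H.dist x y ≤ 12
  obtain ⟨n, hn, hn_close, hn_far⟩ := exists_skipping_subsequence close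
  refine ⟨{
    E := E ∘ n
    a := a ∘ n
    b := b ∘ n
    δ t := if close (n t) then 12 else 6
    isJump t := hE _
    interlaced := hab.comp hn hn fun t => by
      rw [add_comm (n t), add_comm t]
      exact hn.add_le_nat 3 t
    δ_le t := by split_ifs <;> omega
    sep_two t := ?_
    break_or_link t := ?_ }⟩
  · have hlt : n t < n (t + 1) := hn t.lt_succ_self
    have hlt' : n (t + 1) < n (t + 2) := hn (t + 1).lt_succ_self
    by_cases h : n t + 3 ≤ n (t + 2)
    · exact .inl (hab.b_lt_a h)
    have hfar : ¬ close (n t) := fun hc => by have := hn_close t hc; omega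
    have hfar' : ¬ close (n (t + 1)) := fun hc => by
      have : n (t + 2) = n (t + 1) + 2 := hn_close (t + 1) hc
      omega
    have hn_two : n (t + 2) = n t + 2 := by omega
    refine .inr ⟨fun x hx y hy => ?_, by simp [hfar], by simp [hfar']⟩
    rw [Function.comp_apply, hn_two] at hy
    by_contra! hcon
    exact hfar ⟨x, hx, y, hy, hcon⟩
  · by_cases h : close (n t)
    · exact .inr (by simpa only [Function.comp_apply, hn_close t h, if_pos h] using h)
    · simp only [Function.comp_apply, hn_far t h, if_neg h]
      by_cases hclose : ∃ x ∈ E (n t), ∃ y ∈ E (n t + 1), H.dist x y ≤ 6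
      · exact .inr hclose
      · push Not at hclose
        exact .inl ⟨hclose, hoverlap _⟩

theorem exists_apart_along_of_unbounded (hR : IsGeodesicRay H R) {S : Set V}
    (hS : S ⊆ farSet H R 3) (hconn : ConnectedOn H S) (hunb : ∀ n, ∃ z, n ≤ z ∧ Attached H R S z) :
    ∃ A B, ConnectedOn H A ∧ ConnectedOn H B ∧ Apart H 3 A B ∧
      (∀ n, ∃ z, n ≤ z ∧ Attached H R A z) ∧ ∀ n, ∃ z, n ≤ z ∧ Attached H R B z := by
  refine ⟨S, Set.range R, hconn, connectedOn_of_reachableIn (x := R 0) ?_, ?_, hunb,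
    fun n => ⟨n, le_rfl, attached_of_mem ⟨n, rfl⟩⟩⟩
  · rintro _ ⟨i, rfl⟩
    exact .of_seq i.zero_le (fun n _ _ => hR.adj n) fun n _ _ => ⟨n, rfl⟩
  · rintro u hu _ ⟨i, rfl⟩
    exact hS hu i

theorem exists_apart_along (hH : H.Connected) (hfin : ∀ v, (H.neighborSet v).Finite)
    (hR : IsGeodesicRay H R) {i₀ : ℕ}
    (hsep : ∀ i, i₀ ≤ i → ∃ l, i < l ∧ ReachableIn H {v | 1010 < H.dist (R i) v} (R 0) (R l)) :
    ∃ A B, ConnectedOn H A ∧ ConnectedOn H B ∧ Apart H 3 A B ∧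
      (∀ n, ∃ z, n ≤ z ∧ Attached H R A z) ∧ ∀ n, ∃ z, n ≤ z ∧ Attached H R B z := by
  by_cases hunb : ∃ S ⊆ farSet H R 3, ConnectedOn H S ∧ ∀ n, ∃ z, n ≤ z ∧ Attached H R S z
  · obtain ⟨S, hS, hconn, hunb⟩ := hunb
    exact exists_apart_along_of_unbounded hR hS hconn hunb
  have hbdd : ∀ S ⊆ farSet H R 3, ConnectedOn H S → BddAbove {z | Attached H R S z} := by
    intro S hS hconn
    by_contra hnot
    exact hunb ⟨S, hS, hconn, fun n => by
      obtain ⟨z, hz, hnz⟩ := not_bddAbove_iff.1 hnot n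
      exact ⟨z, hnz.le, hz⟩⟩
  obtain ⟨C⟩ := exists_jumpChain hH hfin hR hbdd (i₀ := i₀) fun i hi => by
    obtain ⟨l, hl, h⟩ := hsep i hi
    exact jumpedOver_of_reachableIn hH hR hl h
  have hbreak : {k | C.IsBreak k}.Infinite := fun hfinite => by
    obtain ⟨f, hf⟩ := hfinite.bddAbove
    exact hunb (C.exists_attached_ge_of_forall_not_isBreak hH (f := f + 1) fun k hk hb => by
      have := hf hb
      omega)
  let B := C.blocks hH hR hbreak
  exact ⟨B.route 0, B.route 1, B.connectedOn_route hR 0, B.connectedOn_route hR 1,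
    B.apart_route hR, B.exists_attached_route 0, B.exists_attached_route 1⟩

end Jumps

section Combs

variable {V : Type*} {K : SimpleGraph V}

theorem ReachableIn.map {W : Type*} {K' : SimpleGraph W} (f : K →g K') {S : Set V} {T : Set W}
    (hf : Set.MapsTo f S T) {x y : V} (h : ReachableIn K S x y) :
    ReachableIn K' T (f x) (f y) := by
  obtain ⟨p, hp⟩ := h
  refine ⟨p.map f, fun v hv => ?_⟩
  rw [Walk.support_map, List.mem_map] at hv
  obtain ⟨w, hw, rfl⟩ := hv
  exact hf (hp w hw)

/-- A geodesic from `Y i` to a vertex beyond it misses a finite set `U` as soon as `i` exceeds the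
distance from `Y 0` to every vertex of `U`. -/
theorem exists_geodesicRay_infinite_reachableIn (hK : K.Connected)
    (hfin : ∀ v, (K.neighborSet v).Finite) (o : V) {X : Set V} (hX : X.Infinite) :
    ∃ Y : ℕ → V, Y 0 = o ∧ IsGeodesicRay K Y ∧ ∀ U : Set V, U.Finite →
      ∃ N, ∀ i, N ≤ i → {x ∈ X | ReachableIn K Uᶜ (Y i) x}.Infinite := by
  obtain ⟨Y, rfl, hY, hinf⟩ := exists_geodesicRay_infinite_geodesicallyBeyond hK hfin o hX
  refine ⟨Y, rfl, hY, fun U hU => ?_⟩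
  obtain ⟨L, hL⟩ := (hU.image (K.dist (Y 0))).bddAbove
  refine ⟨L + 1, fun i hi => (hinf i).mono ?_⟩
  rintro x ⟨hxX, hx⟩
  refine ⟨hxX, .of_dist (hK (Y i) x) fun v _ hv hvU => ?_⟩
  have hvL : K.dist (Y 0) v ≤ L := hL ⟨v, hvU, rfl⟩
  have hYi := hY 0 i (Nat.zero_le i)
  have := hK.dist_triangle (u := Y 0) (v := v) (w := x)
  omega

theorem exists_ray_infinite_reachableIn (hfin : ∀ v, (K.neighborSet v).Finite) {S X : Set V}
    (hS : ConnectedOn K S) (hXS : X ⊆ S) (hX : X.Infinite) :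
    ∃ T : K.Ray, T.verts ⊆ S ∧ ∀ U : Set V, U.Finite →
      ∃ N, ∀ i, N ≤ i → {x ∈ X | ReachableIn K Uᶜ (T.vert i) x}.Infinite := by
  obtain ⟨x₀, hx₀⟩ := hX.nonempty
  have hconn : (K.induce S).Connected := by
    have : Nonempty S := ⟨⟨x₀, hXS hx₀⟩⟩
    refine ⟨fun x y => ?_⟩
    obtain ⟨p, hp⟩ := hS x.1 x.2 y.1 y.2
    exact (p.induce S hp).reachable
  have hlocfin : ∀ v, ((K.induce S).neighborSet v).Finite := fun v =>
    ((hfin v.1).preimage Subtype.val_injective.injOn).subset fun w hw => hw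
  obtain ⟨Y, -, hY, hinf⟩ := exists_geodesicRay_infinite_reachableIn hconn hlocfin
    ⟨x₀, hXS hx₀⟩ (hX.preimage (by rwa [Subtype.range_coe]))
  refine ⟨⟨fun n => (Y n).1, Subtype.val_injective.comp hY.injective, hY.adj⟩,
    by rintro _ ⟨n, rfl⟩; exact (Y n).2, fun U hU => ?_⟩
  obtain ⟨N, hN⟩ := hinf (Subtype.val ⁻¹' U) (hU.preimage Subtype.val_injective.injOn)
  refine ⟨N, fun i hi => ((hN i hi).image Subtype.val_injective.injOn).mono ?_⟩
  rintro _ ⟨x, ⟨hxX, hx⟩, rfl⟩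
  exact ⟨hxX, hx.map (Embedding.induce S).toHom fun v hv => hv⟩

/-- Outside every finite set, late terms of `X` are joined to all late terms of `Y`, where how late
may depend on the term of `X`; for rays, this says that they are equivalent. -/
def Linked (K : SimpleGraph V) (X Y : ℕ → V) : Prop :=
  ∀ U : Set V, U.Finite →
    ∃ N, ∀ i, N ≤ i → ∃ N', ∀ j, N' ≤ j → ReachableIn K Uᶜ (X i) (Y j)

theorem infinite_attached {R : ℕ → V} (hK : K.Connected) (hfin : ∀ v, (K.neighborSet v).Finite)
    (hR : IsGeodesicRay K R) {A : Set V} (hA : ∀ n, ∃ z, n ≤ z ∧ Attached K R A z) :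
    {u ∈ A | ∃ z, K.dist u (R z) ≤ 11}.Infinite := by
  intro hcon
  have hz : {z | Attached K R A z}.Infinite :=
    Set.infinite_of_not_bddAbove fun ⟨b, hb⟩ => by
      obtain ⟨z, hzb, hz⟩ := hA (b + 1)
      have : z ≤ b := hb hz
      omega
  refine hz.image hR.injective.injOn
    ((hcon.biUnion fun u _ => finite_dist_le hK hfin u 11).subset ?_)
  rintro _ ⟨z, ⟨u, hu, huz⟩, rfl⟩
  exact Set.mem_biUnion (x := u) ⟨hu, z, huz⟩ huz

theorem Linked.finite_not_reachableIn {R Y : ℕ → V} (h : Linked K R Y) (hK : K.Connected)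
    (hfin : ∀ v, (K.neighborSet v).Finite) {U : Set V} (hU : U.Finite) (r : ℕ) :
    {u | (∃ z, K.dist u (R z) ≤ r) ∧
      ¬ ∃ N, ∀ j, N ≤ j → ReachableIn K Uᶜ u (Y j)}.Finite := by
  obtain ⟨N, hN⟩ := h U hU
  refine ((hU.biUnion fun w _ => finite_dist_le hK hfin w r).union
    ((Set.finite_Iio N).biUnion fun z _ => finite_dist_le hK hfin (R z) r)).subset ?_
  rintro u ⟨⟨z, hz⟩, hnot⟩
  by_contra hu
  simp only [Set.mem_union, Set.mem_iUnion, Set.mem_ofPred_eq, Set.mem_Iio, not_or, not_exists,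
    not_le] at hu
  have hzN : N ≤ z := by
    by_contra! hlt
    have := hu.2 z hlt
    rw [SimpleGraph.dist_comm] at this
    omega
  have huz : ReachableIn K Uᶜ u (R z) := .of_dist (hK u (R z)) fun v _ hv hvU => by
    have := hu.1 v hvU
    rw [SimpleGraph.dist_comm] at this
    omega
  obtain ⟨N', hN'⟩ := hN z hzN
  exact hnot ⟨N', fun j hj => huz.trans (hN' j hj)⟩

end Combs

section Rays

variable {V : Type*} {G : SimpleGraph V} {S T : G.Ray}

theorem toEnd_eq_toEnd : S.toEnd = T.toEnd ↔ S.Equivalent T :=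
  Quotient.eq (r := Ray.setoid G)

theorem reachableIn_of_ray (T : G.Ray) {N : ℕ} {A : Set V} (hA : ∀ k, N ≤ k → T.vert k ∈ A)
    {i j : ℕ} (hi : N ≤ i) (hj : N ≤ j) : ReachableIn G A (T.vert i) (T.vert j) := by
  obtain ⟨p, hp⟩ := T.exists_walk N i j hi hj
  refine ⟨p, fun v hv => ?_⟩
  obtain ⟨k, hk, rfl⟩ := hp v hv
  exact hA k hk

theorem reachable_of_ray (T : G.Ray) (i j : ℕ) : G.Reachable (T.vert i) (T.vert j) := by
  obtain ⟨p, -⟩ := T.exists_walk 0 i j (Nat.zero_le i) (Nat.zero_le j)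
  exact p.reachable

theorem exists_forall_notMem (T : G.Ray) {U : Set V} (hU : U.Finite) :
    ∃ N, ∀ k, N ≤ k → T.vert k ∉ U := by
  simpa using T.exists_avoids hU.toFinset

theorem equivalent_iff_linked : S.Equivalent T ↔ Linked G S.vert T.vert := by
  rw [Ray.equivalent_iff]
  constructor
  · intro h U hU
    obtain ⟨N, hN⟩ := h hU.toFinset
    refine ⟨N, fun i hi => ⟨N, fun j hj => ?_⟩⟩
    obtain ⟨p, hp⟩ := hN i j hi hj
    exact ⟨p, fun v hv => by simpa using hp v hv⟩
  · intro h U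
    obtain ⟨N, hN⟩ := h U U.finite_toSet
    obtain ⟨L, hL⟩ := exists_forall_notMem T U.finite_toSet
    refine ⟨max N L, fun i j hi hj => ?_⟩
    obtain ⟨N', hN'⟩ := hN i (le_of_max_le_left hi)
    exact (hN' (max N' L) (le_max_left _ _)).trans
      (reachableIn_of_ray T hL (le_max_right _ _) (le_of_max_le_right hj))

theorem reachable_of_equivalent (h : S.Equivalent T) (i j : ℕ) :
    G.Reachable (S.vert i) (T.vert j) := by
  obtain ⟨N, hN⟩ := (Ray.equivalent_iff S T).1 h ∅
  obtain ⟨p, -⟩ := hN N N le_rfl le_rfl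
  exact ((reachable_of_ray S i N).trans p.reachable).trans (reachable_of_ray T N j)

theorem exists_lt_dist (hfin : ∀ v, (G.neighborSet v).Finite) {o : V} (T : G.Ray)
    (hT : ∀ k, G.Reachable o (T.vert k)) (M : ℕ) : ∃ N, ∀ k, N ≤ k → M < G.dist o (T.vert k) := by
  obtain ⟨N, hN⟩ := exists_forall_notMem T (finite_edist_le hfin o M)
  refine ⟨N, fun k hk => ?_⟩
  have := hN k hk
  rw [Set.mem_ofPred_eq, ← (hT k).coe_dist_eq_edist] at this
  exact_mod_cast not_le.1 this

theorem exists_ray_avoiding {n : ℕ} {T : Fin n → G.Ray}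
    (hT : ∀ i j, i ≠ j → Disjoint (T i).verts (T j).verts) {U : Set V} (hU : U.encard < n) :
    ∃ i, ∀ j, (T i).vert j ∉ U := by
  by_contra! hcon
  choose g hg using hcon
  have hinj : Function.Injective fun i => (T i).vert (g i) := by
    intro i j hij
    by_contra hne
    exact Set.disjoint_left.1 (hT i j hne) ⟨g i, rfl⟩ ⟨g j, hij.symm⟩
  refine hU.not_ge ?_
  calc (n : ℕ∞) = (Set.univ : Set (Fin n)).encard := by simp [Set.encard_univ]
    _ = (Set.range fun i => (T i).vert (g i)).encard := by
      rw [← Set.image_univ, hinj.encard_image]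
    _ ≤ U.encard := Set.encard_le_encard (Set.range_subset_iff.2 hg)

end Rays

section PowerGraphs

variable {V : Type*} {G : SimpleGraph V} {o : V} {f : ℕ → ℕ}

/-- An admissible radius function for the power graph. By `le_half`, adjacent vertices of the power
graph have distances from the base point that agree up to a factor of about two. -/
structure IsScale (f : ℕ → ℕ) : Prop where
  monotone : Monotone f
  one_le : ∀ t, 1 ≤ f t
  le_half : ∀ t, f t ≤ max 1 (t / 2)

/-- The distance of `u` and `v` is at most `f` at the larger of their distances from `o`; for
monotone `f`, this is the relation that defines the power graph. -/
def IsClose (G : SimpleGraph V) (o : V) (f : ℕ → ℕ) (u v : V) : Prop :=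
  G.dist u v ≤ max (f (G.dist o u)) (f (G.dist o v))

theorem IsClose.symm {u v : V} (h : IsClose G o f u v) : IsClose G o f v u := by
  rw [IsClose, SimpleGraph.dist_comm, max_comm]
  exact h

/-- The graph on the component of `o` that joins any two distinct close vertices, a power of `G`
whose exponent grows slowly with the distance from `o`. -/
def powerGraph (G : SimpleGraph V) (o : V) (f : ℕ → ℕ) : SimpleGraph {v // G.Reachable o v} where
  Adj u v := u ≠ v ∧ IsClose G o f u v
  symm := ⟨fun _ _ h => ⟨h.1.symm, h.2.symm⟩⟩
  loopless := ⟨fun _ h => h.1 rfl⟩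

theorem reachable_coe (u v : {v // G.Reachable o v}) : G.Reachable u.1 v.1 :=
  u.2.symm.trans v.2

theorem dist_coe_triangle (u v w : {v // G.Reachable o v}) :
    G.dist u.1 w.1 ≤ G.dist u.1 v.1 + G.dist v.1 w.1 :=
  (reachable_coe u v).dist_triangle_left w.1

theorem powerGraph_adj_of_adj (hf : IsScale f) {u v : {v // G.Reachable o v}} (h : G.Adj u.1 v.1) :
    (powerGraph G o f).Adj u v := by
  refine ⟨fun huv => h.ne (congrArg Subtype.val huv), ?_⟩
  rw [IsClose, dist_eq_one_iff_adj.2 h]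
  exact (hf.one_le _).trans (le_max_left _ _)

theorem reachableIn_powerGraph (hf : IsScale f) {S : Set {v // G.Reachable o v}}
    {x y : {v // G.Reachable o v}} (h : ReachableIn G {v | ∀ hv, ⟨v, hv⟩ ∈ S} x.1 y.1) :
    ReachableIn (powerGraph G o f) S x y := by
  refine (h.induct
    (P := fun v => ∃ hv : G.Reachable o v, ReachableIn (powerGraph G o f) S x ⟨v, hv⟩) ?_
    ⟨x.2, .refl (h.mem_left x.2)⟩).2
  rintro u v hu hv huv ⟨huo, hxu⟩
  exact ⟨huo.trans huv.reachable,
    hxu.trans (.of_adj (powerGraph_adj_of_adj hf huv) (hu _) (hv _))⟩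

theorem powerGraph_connected (hf : IsScale f) : (powerGraph G o f).Connected := by
  have : Nonempty {v // G.Reachable o v} := ⟨⟨o, .refl o⟩⟩
  refine ⟨fun x y => ?_⟩
  obtain ⟨p⟩ := reachable_coe x y
  obtain ⟨q, -⟩ := reachableIn_powerGraph (S := Set.univ) hf ⟨p, fun _ _ _ => Set.mem_univ _⟩
  exact ⟨q⟩

theorem dist_powerGraph_le (hf : IsScale f) (x y : {v // G.Reachable o v}) :
    (powerGraph G o f).dist x y ≤ G.dist x.1 y.1 := by
  have key : ∀ {u v : V} (p : G.Walk u v) (hu : G.Reachable o u) (hv : G.Reachable o v),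
      (powerGraph G o f).dist ⟨u, hu⟩ ⟨v, hv⟩ ≤ p.length := by
    intro u v p
    induction p with
    | nil => intro hu hv; simp
    | @cons u w v h q ih =>
      intro hu hv
      have hw : G.Reachable o w := hu.trans h.reachable
      have hadj : (powerGraph G o f).Adj ⟨u, hu⟩ ⟨w, hw⟩ := powerGraph_adj_of_adj hf h
      have htri := (powerGraph_connected (G := G) (o := o) hf).dist_triangle
        (u := ⟨u, hu⟩) (v := ⟨w, hw⟩) (w := ⟨v, hv⟩)
      rw [dist_eq_one_iff_adj.2 hadj] at htri
      have := ih hw hv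
      rw [Walk.length_cons]
      omega
  obtain ⟨p, hp⟩ := (reachable_coe x y).exists_walk_length_eq_dist
  exact hp ▸ key p x.2 y.2

theorem dist_powerGraph_le_one {u v : {v // G.Reachable o v}} (h : IsClose G o f u v) :
    (powerGraph G o f).dist u v ≤ 1 := by
  by_cases huv : u = v
  · simp [huv]
  · exact (dist_eq_one_iff_adj.2 (show (powerGraph G o f).Adj u v from ⟨huv, h⟩)).le

theorem IsClose.dist_add_one_le (hf : IsScale f) {u v : {v // G.Reachable o v}}
    (h : IsClose G o f u v) : G.dist o v + 1 ≤ 2 * (G.dist o u + 1) := by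
  have huv : G.dist u.1 v.1 ≤ max (f (G.dist o u)) (f (G.dist o v)) := h
  have := u.2.dist_triangle_left v.1
  have := hf.le_half (G.dist o u)
  have := hf.le_half (G.dist o v)
  omega

theorem finite_isClose (hf : IsScale f) (hfin : ∀ v, (G.neighborSet v).Finite)
    (u : {v // G.Reachable o v}) : {v : {v // G.Reachable o v} | IsClose G o f u v}.Finite := by
  refine ((finite_edist_le hfin o (2 * (G.dist o u + 1))).preimage
    Subtype.val_injective.injOn).subset fun v hv => ?_
  have := IsClose.dist_add_one_le hf hv
  rw [Set.mem_preimage, Set.mem_ofPred_eq, ← v.2.coe_dist_eq_edist]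
  exact_mod_cast (by omega : G.dist o v ≤ 2 * (G.dist o u + 1))

theorem finite_neighborSet_powerGraph (hf : IsScale f) (hfin : ∀ v, (G.neighborSet v).Finite)
    (u : {v // G.Reachable o v}) : ((powerGraph G o f).neighborSet u).Finite :=
  (finite_isClose hf hfin u).subset fun _ hv => hv.2

theorem le_two_pow_mul_and_dist_le (hf : IsScale f) (u v : {v // G.Reachable o v}) {k : ℕ}
    (h : (powerGraph G o f).dist u v ≤ k) :
    G.dist o v + 1 ≤ 2 ^ k * (G.dist o u + 1) ∧
      G.dist u.1 v.1 ≤ k * f (2 ^ k * (G.dist o u + 1)) := by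
  obtain ⟨p, hp⟩ := (powerGraph_connected hf).exists_walk_length_eq_dist u v
  rw [← hp] at h
  clear hp
  induction p generalizing k with
  | @nil u => exact ⟨Nat.le_mul_of_pos_left _ (by positivity), by simp⟩
  | @cons u w v hadj q ih =>
    obtain ⟨k, rfl⟩ : ∃ j, k = j + 1 := ⟨k - 1, by rw [Walk.length_cons] at h; omega⟩
    rw [Walk.length_cons] at h
    obtain ⟨hv, hwv⟩ := ih (k := k) (by omega)
    have hw := hadj.2.dist_add_one_le hf
    have hmono : 2 ^ k * (G.dist o w + 1) ≤ 2 ^ (k + 1) * (G.dist o u + 1) := by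
      rw [pow_succ, mul_assoc]
      exact Nat.mul_le_mul_left _ hw
    have htwo : 2 * (G.dist o u + 1) ≤ 2 ^ (k + 1) * (G.dist o u + 1) :=
      Nat.mul_le_mul_right _ (by
        rw [pow_succ]; exact Nat.le_mul_of_pos_left _ Nat.one_le_two_pow)
    refine ⟨hv.trans hmono, ?_⟩
    calc G.dist u.1 v.1 ≤ G.dist w.1 v.1 + G.dist u.1 w.1 := by
          rw [add_comm]; exact dist_coe_triangle u w v
      _ ≤ k * f (2 ^ (k + 1) * (G.dist o u + 1)) + f (2 ^ (k + 1) * (G.dist o u + 1)) :=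
          add_le_add (hwv.trans (Nat.mul_le_mul_left k (hf.monotone hmono)))
            (hadj.2.trans (max_le (hf.monotone (by omega)) (hf.monotone (by omega))))
      _ = (k + 1) * f (2 ^ (k + 1) * (G.dist o u + 1)) := by ring

theorem IsClose.of_between {u v x : V} (h : IsClose G o f u v)
    (hx : G.dist u x + G.dist x v = G.dist u v) : IsClose G o f x u ∨ IsClose G o f x v := by
  unfold IsClose at *
  rw [G.dist_comm (u := u) (v := x)] at hx
  omega

theorem exists_finite_reachableIn_of_powerGraph (hf : IsScale f)
    (hfin : ∀ v, (G.neighborSet v).Finite) {U : Set V} (hU : U.Finite) :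
    ∃ U' : Set {v // G.Reachable o v}, U'.Finite ∧
      ∀ x y, ReachableIn (powerGraph G o f) U'ᶜ x y → ReachableIn G Uᶜ x.1 y.1 := by
  let U' : Set {v // G.Reachable o v} := {v | ∃ w : {v // G.Reachable o v}, w.1 ∈ U ∧
    IsClose G o f w v}
  have hU' : U'.Finite := ((hU.preimage Subtype.val_injective.injOn).biUnion fun w _ =>
    finite_isClose hf hfin w).subset fun v ⟨w, hwU, hwv⟩ => Set.mem_biUnion hwU hwv
  refine ⟨U', hU', fun x y h => h.induct (P := fun v => ReachableIn G Uᶜ x.1 v.1) ?_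
    (.refl (show x.1 ∉ U from fun hxU => h.mem_left ⟨x, hxU, by simp [IsClose]⟩))⟩
  intro u v hu hv huv hxu
  refine hxu.trans (.of_dist (reachable_coe u v) fun w huw hw hwU => ?_)
  exact (huv.2.of_between hw).elim (fun h => hu ⟨⟨w, u.2.trans huw⟩, hwU, h⟩)
    fun h => hv ⟨⟨w, u.2.trans huw⟩, hwU, h⟩

/-- The vertices on shortest paths of `G` between close vertices of `A`. -/
def expansion (G : SimpleGraph V) (o : V) (f : ℕ → ℕ) (A : Set {v // G.Reachable o v}) : Set V :=
  {x | G.Reachable o x ∧ ∃ u ∈ A, ∃ v ∈ A, IsClose G o f u v ∧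
    G.dist u.1 x + G.dist x v.1 = G.dist u.1 v.1}

variable {A : Set {v // G.Reachable o v}}

theorem coe_mem_expansion {u : {v // G.Reachable o v}} (hu : u ∈ A) : u.1 ∈ expansion G o f A :=
  ⟨u.2, u, hu, u, hu, by simp [IsClose], by simp⟩

theorem exists_isClose_of_mem_expansion {x : V} (hx : x ∈ expansion G o f A) :
    ∃ u ∈ A, IsClose G o f x u := by
  obtain ⟨-, u, hu, v, hv, huv, hxuv⟩ := hx
  exact (huv.of_between hxuv).elim (fun h => ⟨u, hu, h⟩) fun h => ⟨v, hv, h⟩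

theorem connectedOn_expansion (hA : ConnectedOn (powerGraph G o f) A) :
    ConnectedOn G (expansion G o f A) := by
  have hbetween : ∀ x ∈ expansion G o f A,
      ∃ u ∈ A, ReachableIn G (expansion G o f A) u.1 x := by
    rintro x ⟨hx, u, hu, v, hv, hclose, hxuv⟩
    refine ⟨u, hu, .of_dist (u.2.symm.trans hx) fun w huw hw => ?_⟩
    have hwo := u.2.trans huw
    refine ⟨hwo, u, hu, v, hv, hclose, ?_⟩
    have hwv : G.dist w v.1 ≤ G.dist w x + G.dist x v.1 := dist_coe_triangle ⟨w, hwo⟩ ⟨x, hx⟩ v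
    have huv : G.dist u.1 v.1 ≤ G.dist u.1 w + G.dist w v.1 := dist_coe_triangle u ⟨w, hwo⟩ v
    omega
  have hlift : ∀ u ∈ A, ∀ v ∈ A, ReachableIn G (expansion G o f A) u.1 v.1 := by
    intro u hu v hv
    refine (hA u hu v hv).induct
      (P := fun v => ReachableIn G (expansion G o f A) u.1 v.1) ?_
      (.refl (coe_mem_expansion hu))
    intro v w hv hw hvw huv
    exact huv.trans (.of_dist (reachable_coe v w) fun x hx hvxw =>
      ⟨v.2.trans hx, v, hv, w, hw, hvw.2, hvxw⟩)
  intro x hx y hy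
  obtain ⟨u, hu, hux⟩ := hbetween x hx
  obtain ⟨v, hv, hvy⟩ := hbetween y hy
  exact (hux.symm.trans (hlift u hu v hv)).trans hvy

theorem lt_dist_of_apart (hf : IsScale f) {B : Set {v // G.Reachable o v}}
    (hAB : Apart (powerGraph G o f) 3 A B) {x y : V} (hx : x ∈ expansion G o f A)
    (hy : y ∈ expansion G o f B) : f (G.dist o x) < G.dist x y := by
  by_contra! hxy
  obtain ⟨u, hu, hxu⟩ := exists_isClose_of_mem_expansion hx
  obtain ⟨v, hv, hyv⟩ := exists_isClose_of_mem_expansion hy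
  have h₁ := dist_powerGraph_le_one (u := u) (v := ⟨x, hx.1⟩) hxu.symm
  have h₂ := dist_powerGraph_le_one (u := ⟨x, hx.1⟩) (v := ⟨y, hy.1⟩)
    (hxy.trans (le_max_left _ _))
  have h₃ := dist_powerGraph_le_one (u := ⟨y, hy.1⟩) (v := v) hyv
  have hconn := powerGraph_connected (G := G) (o := o) hf
  have := hAB u hu v hv
  have := hconn.dist_triangle (u := u) (v := ⟨x, hx.1⟩) (w := v)
  have := hconn.dist_triangle (u := ⟨x, hx.1⟩) (v := ⟨y, hy.1⟩) (w := v)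
  omega

end PowerGraphs

section EndsInPowerGraphs

variable {V : Type*} {G : SimpleGraph V} {o : V} {f : ℕ → ℕ}

theorem exists_isScale (τ : ℕ → ℕ) : ∃ f : ℕ → ℕ, IsScale f ∧
    (∀ t, 2 ≤ f t → τ (f t) ≤ t) ∧ Filter.Tendsto f .atTop .atTop := by
  classical
  let P : ℕ → ℕ → Prop := fun t n => ∀ k ≤ n, τ k ≤ t
  refine ⟨fun t => max 1 (Nat.findGreatest (P t) (t / 2)), ⟨fun s t hst => ?_,
    fun t => le_max_left _ _, fun t => max_le_max le_rfl (Nat.findGreatest_le _)⟩,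
    fun t ht => ?_, Filter.tendsto_atTop.2 fun n => Filter.eventually_atTop.2 ?_⟩
  · exact max_le_max le_rfl (Nat.findGreatest_mono
      (fun n hn k hk => (hn k hk).trans hst) (Nat.div_le_div_right hst))
  · have htwo : 2 ≤ max 1 (Nat.findGreatest (P t) (t / 2)) := ht
    have hP : P t (Nat.findGreatest (P t) (t / 2)) :=
      Nat.findGreatest_of_ne_zero rfl (by omega)
    exact hP (max 1 _) (max_le (by omega) le_rfl)
  · refine ⟨max (2 * n) ((Finset.range (n + 1)).sup τ), fun t ht => ?_⟩
    refine le_max_of_le_right (Nat.le_findGreatest (by omega) fun k hk => ?_)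
    exact (Finset.le_sup (f := τ) (Finset.mem_range.2 (Nat.lt_succ_of_le hk))).trans
      ((le_max_right _ _).trans ht)

theorem exists_ray_avoiding_ball {Δ : ℕ} (hdeg : ∀ v, (G.neighborSet v).encard ≤ Δ) (v : V)
    (r : ℕ) {T : Fin ((Δ + 1) ^ r + 1) → G.Ray}
    (hT : ∀ i j, i ≠ j → Disjoint (T i).verts (T j).verts) :
    ∃ i, ∀ j, (r : ℕ∞) < G.edist v ((T i).vert j) := by
  obtain ⟨i, hi⟩ := exists_ray_avoiding hT (U := {w | G.edist v w ≤ r})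
    ((encard_edist_le hdeg v r).trans_lt (by exact_mod_cast Nat.lt_succ_self _))
  exact ⟨i, fun j => not_le.1 (hi j)⟩

/-- Around a vertex `v` far from `o`, the ball of radius `N` of the power graph lies in a ball of
`G` of radius `N * n`, where `n` is the value of `f` near `v`. It contains at most
`(Δ + 1) ^ (N * n)` vertices, so among one more than that many disjoint rays of the end some ray
misses it. As `f` grows slowly, all these rays start closer to `o` than the ball. -/
theorem exists_powerGraph_escape {Δ : ℕ} (hdeg : ∀ v, (G.neighborSet v).encard ≤ Δ) {ρ : G.Ray}
    (hthick : ρ.toEnd.IsThick) (N : ℕ) :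
    ∃ f, IsScale f ∧ Filter.Tendsto f .atTop .atTop ∧
      ∃ i₀, ∀ v : {v // G.Reachable o v}, i₀ ≤ G.dist o v →
        ∃ T : G.Ray, T.Equivalent ρ ∧ ∀ hT : ∀ j, G.Reachable o (T.vert j), ∀ j,
          ReachableIn (powerGraph G o f) {w | N < (powerGraph G o f).dist v w} ⟨o, .refl o⟩
            ⟨T.vert j, hT j⟩ := by
  choose T hT hdisj using fun n : ℕ => hthick ((Δ + 1) ^ (N * n) + 1)
  let start : ℕ → ℕ := fun n => Finset.univ.sup fun i => G.dist o ((T n i).vert 0)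
  have hstart : ∀ n i, G.dist o ((T n i).vert 0) ≤ start n := fun n i =>
    Finset.le_sup (f := fun i => G.dist o ((T n i).vert 0)) (Finset.mem_univ i)
  obtain ⟨f, hf, hτ, hlim⟩ :=
    exists_isScale fun n => 2 ^ N * (2 ^ N * (start n + 1) + 1)
  refine ⟨f, hf, hlim, 2 ^ N * (start 1 + 1), fun v hv => ?_⟩
  set n := f (2 ^ N * (G.dist o v + 1)) with hn
  have hfar : 2 ^ N * (start n + 1) < G.dist o v + 1 := by
    rcases (hf.one_le (2 ^ N * (G.dist o v + 1))).eq_or_lt with hone | htwo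
    · rw [hn, ← hone]
      omega
    · have hn_le : 2 ^ N * (2 ^ N * (start n + 1) + 1) ≤ 2 ^ N * (G.dist o v + 1) := hτ _ htwo
      exact Nat.le_of_mul_le_mul_left hn_le (by positivity)
  have hstart_lt : ∀ w : {v // G.Reachable o v}, (powerGraph G o f).dist v w ≤ N →
      start n < G.dist o w := fun w hw => by
    have hvw := (le_two_pow_mul_and_dist_le hf w v (SimpleGraph.dist_comm.trans_le hw)).1
    have := lt_of_mul_lt_mul_left (hfar.trans_le hvw) (by positivity)
    omega
  obtain ⟨i, hi⟩ := exists_ray_avoiding_ball hdeg v.1 (N * n) (hdisj n)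
  refine ⟨T n i, toEnd_eq_toEnd.1 (hT n i), fun hreach j => reachableIn_powerGraph hf ?_⟩
  refine ReachableIn.trans (y := (T n i).vert 0) (.of_dist (hreach 0) fun w _ hw hwo => ?_)
    (reachableIn_of_ray (T n i) (N := 0) (fun k _ => ?_) le_rfl (Nat.zero_le j))
  · by_contra hball
    have := hstart_lt ⟨w, hwo⟩ (not_lt.1 hball)
    have := hstart n i
    dsimp only at *
    omega
  · intro hk
    by_contra hball
    have hvk := (le_two_pow_mul_and_dist_le hf v ⟨_, hk⟩ (not_lt.1 hball)).2
    refine (hi k).not_ge ?_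
    rw [← (v.2.symm.trans hk).coe_dist_eq_edist]
    exact_mod_cast hvk

variable (hf : IsScale f) (hfin : ∀ v, (G.neighborSet v).Finite) {ρ : G.Ray}
  (hρ : ∀ j, G.Reachable o (ρ.vert j))
include hf hfin

theorem exists_geodesicRay_linked :
    ∃ R, R 0 = ⟨o, .refl o⟩ ∧ IsGeodesicRay (powerGraph G o f) R ∧
      Linked (powerGraph G o f) R fun j => ⟨ρ.vert j, hρ j⟩ := by
  let Y : ℕ → {v // G.Reachable o v} := fun j => ⟨ρ.vert j, hρ j⟩
  have hY : Function.Injective Y := fun i j hij => ρ.inj (congrArg Subtype.val hij)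
  obtain ⟨R, hR₀, hR, hinf⟩ := exists_geodesicRay_infinite_reachableIn (powerGraph_connected hf)
    (finite_neighborSet_powerGraph hf hfin) ⟨o, .refl o⟩ (Set.infinite_range_of_injective hY)
  refine ⟨R, hR₀, hR, fun U hU => ?_⟩
  obtain ⟨M, hM⟩ := exists_forall_notMem ρ (hU.image Subtype.val)
  obtain ⟨N, hN⟩ := hinf U hU
  refine ⟨N, fun i hi => ?_⟩
  obtain ⟨_, ⟨⟨n, rfl⟩, hRn⟩, hnM⟩ :=
    (hN i hi).exists_notMem_finite ((Set.finite_Iio M).image Y)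
  have hMn : M ≤ n := not_lt.1 fun hlt => hnM ⟨n, hlt, rfl⟩
  refine ⟨M, fun j hj => hRn.trans (reachableIn_powerGraph hf ?_)⟩
  refine reachableIn_of_ray ρ (fun k hk => ?_) hMn hj
  exact fun _ hkU => hM k hk ⟨_, hkU, rfl⟩

theorem exists_ray_mem_expansion {R : ℕ → {v // G.Reachable o v}}
    (hR : IsGeodesicRay (powerGraph G o f) R)
    (hlim : Linked (powerGraph G o f) R fun j => ⟨ρ.vert j, hρ j⟩)
    {A : Set {v // G.Reachable o v}} (hA : ConnectedOn (powerGraph G o f) A)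
    (hatt : ∀ n, ∃ z, n ≤ z ∧ Attached (powerGraph G o f) R A z) :
    ∃ T : G.Ray, T.Equivalent ρ ∧ T.verts ⊆ expansion G o f A := by
  have hconn := powerGraph_connected (G := G) (o := o) hf
  have hlocfin := finite_neighborSet_powerGraph (G := G) (o := o) hf hfin
  let X : Set {v // G.Reachable o v} := {u ∈ A | ∃ z, (powerGraph G o f).dist u (R z) ≤ 11}
  have hX : (Subtype.val '' X).Infinite :=
    (infinite_attached hconn hlocfin hR hatt).image Subtype.val_injective.injOn
  obtain ⟨T, hTA, hT⟩ := exists_ray_infinite_reachableIn hfin (connectedOn_expansion hA)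
    (Set.image_subset_iff.2 fun u hu => coe_mem_expansion hu.1) hX
  refine ⟨T, equivalent_iff_linked.2 fun U hU => ?_, hTA⟩
  obtain ⟨U', hU', hdescend⟩ := exists_finite_reachableIn_of_powerGraph (o := o) hf hfin hU
  obtain ⟨N, hN⟩ := hT U hU
  refine ⟨N, fun i hi => ?_⟩
  obtain ⟨_, ⟨⟨u, hu, rfl⟩, hTu⟩, hgood⟩ := (hN i hi).exists_notMem_finite
    ((hlim.finite_not_reachableIn hconn hlocfin hU' 11).image Subtype.val)
  obtain ⟨N', hN'⟩ : ∃ N', ∀ j, N' ≤ j →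
      ReachableIn (powerGraph G o f) U'ᶜ u ⟨ρ.vert j, hρ j⟩ := by
    by_contra hnot
    exact hgood ⟨u, ⟨hu.2, hnot⟩, rfl⟩
  exact ⟨N', fun j hj => hTu.trans (hdescend _ _ (hN' j hj))⟩

theorem exists_reachableIn_beyond {R : ℕ → {v // G.Reachable o v}} (hR₀ : R 0 = ⟨o, .refl o⟩)
    (hlim : Linked (powerGraph G o f) R fun j => ⟨ρ.vert j, hρ j⟩) {T : G.Ray}
    (hT : T.Equivalent ρ) (hTo : ∀ j, G.Reachable o (T.vert j))
    {v : {v // G.Reachable o v}} {r : ℕ}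
    (hTv : ∀ j, ReachableIn (powerGraph G o f) {w | r < (powerGraph G o f).dist v w} ⟨o, .refl o⟩
      ⟨T.vert j, hTo j⟩) (i : ℕ) :
    ∃ l, i < l ∧
      ReachableIn (powerGraph G o f) {w | r < (powerGraph G o f).dist v w} (R 0) (R l) := by
  let U : Set {v // G.Reachable o v} := {w | (powerGraph G o f).dist v w ≤ r}
  have hU : U.Finite := finite_dist_le (powerGraph_connected hf)
    (finite_neighborSet_powerGraph hf hfin) v r
  have hUc : Uᶜ = {w | r < (powerGraph G o f).dist v w} := by ext; simp [U]
  rw [← hUc] at hTv ⊢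
  obtain ⟨N₁, hN₁⟩ := equivalent_iff_linked.1 hT _ (hU.image Subtype.val)
  obtain ⟨j₁, hj₁⟩ := hN₁ N₁ le_rfl
  obtain ⟨N₂, hN₂⟩ := hlim U hU
  obtain ⟨j₂, hj₂⟩ := hN₂ (max N₂ (i + 1)) (le_max_left _ _)
  refine ⟨max N₂ (i + 1), by omega, hR₀ ▸ ?_⟩
  have hTρ : ReachableIn (powerGraph G o f) Uᶜ ⟨T.vert N₁, hTo N₁⟩
      ⟨ρ.vert (max j₁ j₂), hρ (max j₁ j₂)⟩ :=
    reachableIn_powerGraph hf ((hj₁ _ (le_max_left _ _)).mono fun w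
      (hw : w ∉ Subtype.val '' U) hwo hwU => hw ⟨_, hwU, rfl⟩)
  exact ((hTv N₁).trans hTρ).trans (hj₂ _ (le_max_right _ _)).symm

end EndsInPowerGraphs

section Tails

variable {V : Type*} {G : SimpleGraph V} {P Q S T : G.Ray}

/-- The tail of a ray that starts at the vertex of index `k`. -/
def tailFrom (T : G.Ray) (k : ℕ) : G.Ray where
  vert n := T.vert (k + n)
  inj _ _ h := Nat.add_left_cancel (T.inj h)
  adj n := T.adj (k + n)

theorem isTail_tailFrom (T : G.Ray) (k : ℕ) : (tailFrom T k).IsTail T := ⟨k, fun _ => rfl⟩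

/-- Two rays have a common tail if they agree from some vertex on, possibly at shifted indices. -/
def HasCommonTail (S T : G.Ray) : Prop :=
  ∃ a b, ∀ n, S.vert (a + n) = T.vert (b + n)

theorem HasCommonTail.equivalent (h : HasCommonTail S T) : S.Equivalent T := by
  obtain ⟨a, b, hab⟩ := h
  refine equivalent_iff_linked.2 fun U hU => ?_
  obtain ⟨N, hN⟩ := exists_forall_notMem S hU
  obtain ⟨M, hM⟩ := exists_forall_notMem T hU
  refine ⟨N, fun i hi => ⟨M, fun j hj => ?_⟩⟩
  have hS := reachableIn_of_ray S (A := Uᶜ) hN hi (by omega : N ≤ a + (N + M))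
  rw [hab] at hS
  exact hS.trans (reachableIn_of_ray T hM (by omega) hj)

theorem HasCommonTail.exists_isTail (h : HasCommonTail S P) {P' : G.Ray} (hP' : P'.IsTail P) :
    ∃ S' : G.Ray, S'.IsTail S ∧ S'.verts ⊆ P'.verts := by
  obtain ⟨a, b, hab⟩ := h
  obtain ⟨k, hk⟩ := hP'
  refine ⟨tailFrom S (a + k), isTail_tailFrom S _, ?_⟩
  rintro _ ⟨n, rfl⟩
  refine ⟨b + n, ?_⟩
  calc P'.vert (b + n) = P.vert (b + (k + n)) := by rw [hk, Nat.add_left_comm]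
    _ = S.vert (a + k + n) := by rw [← hab, Nat.add_assoc]

theorem setEDist_anti {U U' W W' : Set V} (hU : U' ⊆ U) (hW : W' ⊆ W) :
    G.setEDist U W ≤ G.setEDist U' W' :=
  le_iInf₂ fun u hu => le_iInf₂ fun w hw => iInf₂_le_of_le u (hU hu) (iInf₂_le w (hW hw))

theorem diverge_symm (h : S.Diverge T) : T.Diverge S := by
  intro n
  obtain ⟨S', T', hS', hT', hn⟩ := h n
  refine ⟨T', S', hT', hS', hn.trans_le (le_iInf₂ fun u hu => le_iInf₂ fun w hw => ?_)⟩
  rw [edist_comm]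
  exact iInf₂_le_of_le w hw (iInf₂_le u hu)

theorem diverge_of_hasCommonTail (h : P.Diverge Q) (hS : HasCommonTail S P)
    (hT : HasCommonTail T Q) : S.Diverge T := by
  intro n
  obtain ⟨P', Q', hP', hQ', hn⟩ := h n
  obtain ⟨S', hS', hSP⟩ := hS.exists_isTail hP'
  obtain ⟨T', hT', hTQ⟩ := hT.exists_isTail hQ'
  exact ⟨S', T', hS', hT', hn.trans_le (setEDist_anti hSP hTQ)⟩

theorem diverge_of_lt_dist
    (h : ∀ n, ∃ N, ∀ i j, N ≤ i → N ≤ j → n < G.dist (P.vert i) (Q.vert j)) : P.Diverge Q := by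
  intro n
  obtain ⟨N, hN⟩ := h n
  refine ⟨tailFrom P N, tailFrom Q N, isTail_tailFrom P N, isTail_tailFrom Q N, ?_⟩
  refine lt_of_lt_of_le (b := ((n + 1 : ℕ) : ℕ∞)) (by exact_mod_cast n.lt_succ_self) ?_
  refine le_iInf₂ fun u ⟨i, hi⟩ => le_iInf₂ fun w ⟨j, hj⟩ => ?_
  have hlt : n < G.dist u w := by
    rw [← hi, ← hj]
    exact hN _ _ (Nat.le_add_right N i) (Nat.le_add_right N j)
  rw [← (Reachable.of_dist_ne_zero (by omega : G.dist u w ≠ 0)).coe_dist_eq_edist]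
  exact_mod_cast hlt

end Tails

section DivergingRays

variable {V : Type*} {G : SimpleGraph V}

theorem exists_diverging_rays {Δ : ℕ} (hdeg : ∀ v, (G.neighborSet v).encard ≤ Δ) {ρ : G.Ray}
    (hthick : ρ.toEnd.IsThick) :
    ∃ P Q : G.Ray, P.Equivalent ρ ∧ Q.Equivalent ρ ∧ Disjoint P.verts Q.verts ∧ P.Diverge Q := by
  have hfin : ∀ v, (G.neighborSet v).Finite := fun v => Set.finite_of_encard_le_coe (hdeg v)
  have hρ := reachable_of_ray ρ 0
  obtain ⟨f, hf, hlim, i₀, hescape⟩ :=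
    exists_powerGraph_escape (o := ρ.vert 0) hdeg hthick 1010
  obtain ⟨R, hR₀, hR, hlink⟩ := exists_geodesicRay_linked hf hfin hρ
  have hnorm : ∀ i, i ≤ G.dist (ρ.vert 0) (R i) := fun i => by
    have h := dist_powerGraph_le hf (R 0) (R i)
    rwa [hR 0 i i.zero_le, Nat.sub_zero, hR₀] at h
  obtain ⟨A, B, hA, hB, hAB, hAR, hBR⟩ := exists_apart_along (powerGraph_connected hf)
    (finite_neighborSet_powerGraph hf hfin) hR (i₀ := i₀) fun i hi => by
      obtain ⟨T, hT, hTi⟩ := hescape (R i) (hi.trans (hnorm i))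
      have hTo := reachable_of_equivalent ((Ray.equivalent_equivalence G).symm hT) 0
      exact exists_reachableIn_beyond hf hfin hρ hR₀ hlink hT hTo (hTi hTo) i
  obtain ⟨P, hP, hPA⟩ := exists_ray_mem_expansion hf hfin hρ hR hlink hA hAR
  obtain ⟨Q, hQ, hQB⟩ := exists_ray_mem_expansion hf hfin hρ hR hlink hB hBR
  have hfar : ∀ i j, f (G.dist (ρ.vert 0) (P.vert i)) < G.dist (P.vert i) (Q.vert j) :=
    fun i j => lt_dist_of_apart hf hAB (hPA ⟨i, rfl⟩) (hQB ⟨j, rfl⟩)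
  refine ⟨P, Q, hP, hQ, Set.disjoint_left.2 ?_, diverge_of_lt_dist fun n => ?_⟩
  · rintro _ ⟨i, rfl⟩ ⟨j, hij⟩
    have := hfar i j
    rw [hij, SimpleGraph.dist_self] at this
    omega
  · obtain ⟨M, hM⟩ := Filter.tendsto_atTop_atTop.1 hlim n
    obtain ⟨N, hN⟩ := exists_lt_dist hfin P
      (reachable_of_equivalent ((Ray.equivalent_equivalence G).symm hP) 0) M
    exact ⟨N, fun i j hi _ => (hM _ (hN i hi).le).trans_lt (hfar i j)⟩

end DivergingRays

section DoubleRays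

variable {V : Type*} {G : SimpleGraph V}

theorem exists_isPath_between {S T : Set V} {x₀ y₀ : V} (hx₀ : x₀ ∈ S) (hy₀ : y₀ ∈ T)
    (h : G.Reachable x₀ y₀) :
    ∃ x ∈ S, ∃ y ∈ T, ∃ p : G.Walk x y, p.IsPath ∧ (∀ v ∈ p.support, v ∈ S → v = x) ∧
      ∀ v ∈ p.support, v ∈ T → v = y := by
  classical
  have hex : ∃ n, ∃ x ∈ S, ∃ y ∈ T, ∃ p : G.Walk x y, p.length = n :=
    ⟨_, x₀, hx₀, y₀, hy₀, h.some, rfl⟩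
  obtain ⟨x, hx, y, hy, p, hp⟩ := Nat.find_spec hex
  have hmin : ∀ {x' y'} (q : G.Walk x' y'), x' ∈ S → y' ∈ T → p.length ≤ q.length :=
    fun q hx' hy' => hp ▸ Nat.find_min' hex ⟨_, hx', _, hy', q, rfl⟩
  refine ⟨x, hx, y, hy, p, p.isPath_of_length_eq_dist ?_, fun v hv hvS => ?_, fun v hv hvT => ?_⟩
  · obtain ⟨q, hq⟩ := p.reachable.exists_walk_length_eq_dist
    exact (hq ▸ hmin q hx hy).antisymm (dist_le p)
  · by_contra hne
    exact (Walk.length_dropUntil_lt_length hv hne).not_ge (hmin _ hvS hy)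
  · by_contra hne
    exact (Walk.length_takeUntil_lt_length hv hne).not_ge (hmin _ hx hvT)

/-- The ray `u, T.vert 0, T.vert 1, …`. -/
def consRay (u : V) (T : G.Ray) (hadj : G.Adj u (T.vert 0)) (hu : u ∉ T.verts) : G.Ray where
  vert
    | 0 => u
    | n + 1 => T.vert n
  inj
    | 0, 0, _ => rfl
    | 0, n + 1, h => (hu ⟨n, h.symm⟩).elim
    | n + 1, 0, h => (hu ⟨n, h⟩).elim
    | _ + 1, _ + 1, h => congrArg Nat.succ (T.inj h)
  adj
    | 0 => hadj
    | n + 1 => T.adj n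

theorem exists_ray_of_isPath {u v : V} (p : G.Walk u v) (hp : p.IsPath) (T : G.Ray)
    (hv : T.vert 0 = v) (hT : ∀ w ∈ p.support, w ∈ T.verts → w = v) :
    ∃ S : G.Ray, S.vert 0 = u ∧ (∀ n, S.vert (p.length + n) = T.vert n) ∧
      ∀ w ∈ S.verts, w ∈ p.support ∨ w ∈ T.verts := by
  induction p with
  | nil => exact ⟨T, hv, fun n => by simp, fun w hw => Or.inr hw⟩
  | @cons u u' v huu' q ih =>
    rw [Walk.cons_isPath_iff] at hp
    obtain ⟨S, rfl, hST, hSq⟩ := ih hp.1 hv fun w hw => hT w (List.mem_cons_of_mem _ hw)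
    have huT : u ∉ T.verts := fun hu =>
      hp.2 (hT u List.mem_cons_self hu ▸ q.end_mem_support)
    refine ⟨consRay u S huu' fun hu => (hSq u hu).elim hp.2 huT, rfl, fun n => ?_, ?_⟩
    · rw [Walk.length_cons, Nat.add_right_comm]
      exact hST n
    · rintro w ⟨_ | n, rfl⟩
      · exact Or.inl List.mem_cons_self
      · exact (hSq _ ⟨n, rfl⟩).imp_left (List.mem_cons_of_mem _)

/-- The double ray that runs through `S` backwards and then through `T`, for two rays `S` and `T`
that have their first vertex and no other vertex in common. -/
def joinRays (S T : G.Ray) (h₀ : S.vert 0 = T.vert 0)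
    (h : ∀ m n, S.vert m = T.vert n → m = 0) : G.DoubleRay where
  vert
    | .ofNat n => T.vert n
    | .negSucc n => S.vert (n + 1)
  inj
    | .ofNat _, .ofNat _, hmn => congrArg Int.ofNat (T.inj hmn)
    | .ofNat _, .negSucc _, hmn => absurd (h _ _ hmn.symm) (Nat.succ_ne_zero _)
    | .negSucc _, .ofNat _, hmn => absurd (h _ _ hmn) (Nat.succ_ne_zero _)
    | .negSucc _, .negSucc _, hmn => congrArg Int.negSucc (Nat.succ_injective (S.inj hmn))
  adj
    | .ofNat n => T.adj n
    | .negSucc 0 => show G.Adj (S.vert 1) (T.vert 0) from h₀ ▸ (S.adj 0).symm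
    | .negSucc (n + 1) => (S.adj (n + 1)).symm

theorem exists_doubleRay {P Q : G.Ray} (hPQ : Disjoint P.verts Q.verts)
    (hreach : G.Reachable (P.vert 0) (Q.vert 0)) :
    ∃ D : G.DoubleRay, ∃ i j L : ℕ, (∀ n : ℕ, D.vert (-n) = P.vert (i + n)) ∧
      ∀ n : ℕ, D.vert (L + n) = Q.vert (j + n) := by
  obtain ⟨_, ⟨i, rfl⟩, _, ⟨j, rfl⟩, p, hp, hpP, hpQ⟩ :=
    exists_isPath_between (S := P.verts) (T := Q.verts) ⟨0, rfl⟩ ⟨0, rfl⟩ hreach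
  obtain ⟨T, hT₀, hTQ, hT⟩ := exists_ray_of_isPath p hp (tailFrom Q j) rfl
    fun w hw ⟨n, hn⟩ => hpQ w hw ⟨j + n, hn⟩
  have hinter : ∀ m n, (tailFrom P i).vert m = T.vert n → m = 0 := fun m n hmn => by
    have hm : T.vert n ∈ P.verts := ⟨i + m, hmn⟩
    rcases hT _ ⟨n, rfl⟩ with hn | ⟨k, hk⟩
    · exact Nat.add_eq_left.1 (P.inj (hmn.trans (hpP _ hn hm)))
    · exact (Set.disjoint_left.1 hPQ hm ⟨j + k, hk⟩).elim
  refine ⟨joinRays (tailFrom P i) T hT₀.symm hinter, i, j, p.length, ?_, hTQ⟩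
  rintro (_ | n)
  · exact hT₀
  · rfl

variable {P Q T T' : G.Ray} {D : G.DoubleRay} {i j L : ℕ} {k k' : ℤ}

theorem hasCommonTail_of_forward (hD : ∀ n : ℕ, D.vert (L + n) = Q.vert (j + n))
    (hT : ∀ n : ℕ, T.vert n = D.vert (k + n)) : HasCommonTail T Q := by
  refine ⟨(L - k).toNat, j + (k - L).toNat, fun n => ?_⟩
  rw [hT, add_assoc, ← hD]
  congr 1
  omega

theorem hasCommonTail_of_backward (hD : ∀ n : ℕ, D.vert (-n) = P.vert (i + n))
    (hT : ∀ n : ℕ, T.vert n = D.vert (k - n)) : HasCommonTail T P := by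
  refine ⟨k.toNat, i + (-k).toNat, fun n => ?_⟩
  rw [hT, add_assoc, ← hD]
  congr 1
  omega

theorem not_disjoint_of_forward (hT : ∀ n : ℕ, T.vert n = D.vert (k + n))
    (hT' : ∀ n : ℕ, T'.vert n = D.vert (k' + n)) : ¬ Disjoint T.verts T'.verts := by
  refine Set.not_disjoint_iff.2 ⟨D.vert (max k k'), ⟨(k' - k).toNat, ?_⟩, ⟨(k - k').toNat, ?_⟩⟩
  · rw [hT]; congr 1; omega
  · rw [hT']; congr 1; omega

theorem not_disjoint_of_backward (hT : ∀ n : ℕ, T.vert n = D.vert (k - n))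
    (hT' : ∀ n : ℕ, T'.vert n = D.vert (k' - n)) : ¬ Disjoint T.verts T'.verts := by
  refine Set.not_disjoint_iff.2 ⟨D.vert (min k k'), ⟨(k - k').toNat, ?_⟩, ⟨(k' - k).toNat, ?_⟩⟩
  · rw [hT]; congr 1; omega
  · rw [hT']; congr 1; omega

theorem exists_doubleRay_hasCommonTail (hPQ : Disjoint P.verts Q.verts)
    (hreach : G.Reachable (P.vert 0) (Q.vert 0)) :
    ∃ D : G.DoubleRay, (∀ T : G.Ray, T.IsTailOfDouble D → HasCommonTail T P ∨ HasCommonTail T Q) ∧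
      ∀ T T' : G.Ray, T.IsTailOfDouble D → T'.IsTailOfDouble D → Disjoint T.verts T'.verts →
        HasCommonTail T P ∧ HasCommonTail T' Q ∨ HasCommonTail T Q ∧ HasCommonTail T' P := by
  obtain ⟨D, i, j, L, hDP, hDQ⟩ := exists_doubleRay hPQ hreach
  refine ⟨D, ?_, ?_⟩
  · rintro T (⟨k, hT⟩ | ⟨k, hT⟩)
    · exact Or.inr (hasCommonTail_of_forward hDQ hT)
    · exact Or.inl (hasCommonTail_of_backward hDP hT)
  · rintro T T' (⟨k, hT⟩ | ⟨k, hT⟩) (⟨k', hT'⟩ | ⟨k', hT'⟩) hdisj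
    · exact (not_disjoint_of_forward hT hT' hdisj).elim
    · exact Or.inr ⟨hasCommonTail_of_forward hDQ hT, hasCommonTail_of_backward hDP hT'⟩
    · exact Or.inl ⟨hasCommonTail_of_backward hDP hT, hasCommonTail_of_forward hDQ hT'⟩
    · exact (not_disjoint_of_backward hT hT' hdisj).elim

end DoubleRays

end ThickEnd

open SimpleGraph ThickEnd

theorem theorem4p1 {V : Type*} (G : SimpleGraph V)
    (hdeg : ∃ Δ : ℕ, ∀ v : V, (G.neighborSet v).encard ≤ Δ)
    (ε : G.RayEnd) (hε : ε.IsThick) :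
    ∃ D : G.DoubleRay, D.LiesIn ε ∧ D.Diverges := by
  obtain ⟨Δ, hdeg⟩ := hdeg
  obtain ⟨ρ, rfl⟩ : ∃ ρ : G.Ray, ρ.toEnd = ε := Quotient.exists_rep ε
  obtain ⟨P, Q, hP, hQ, hPQ, hdiv⟩ := exists_diverging_rays hdeg hε
  have hequiv := Ray.equivalent_equivalence G
  obtain ⟨D, htail, hdisj⟩ := exists_doubleRay_hasCommonTail hPQ
    (reachable_of_equivalent (hequiv.trans hP (hequiv.symm hQ)) 0 0)
  refine ⟨D, fun T hT => toEnd_eq_toEnd.2 ?_, fun T T' hT hT' hTT' => ?_⟩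
  · exact (htail T hT).elim (fun h => hequiv.trans h.equivalent hP)
      fun h => hequiv.trans h.equivalent hQ
  · exact (hdisj T T' hT hT' hTT').elim (fun h => diverge_of_hasCommonTail hdiv h.1 h.2)
      fun h => diverge_symm (diverge_of_hasCommonTail hdiv h.2 h.1)
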